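/- **Theorem 5 (Unitary equivalence of $L_\pm$ to $|\nabla|$ on the continuous spectrum).** Let $m \geq 1$ be an integer and $$Q_m(x) = \left( \mathrm{i}\cdot\frac{x-\mathrm{i}}{x+\mathrm{i}} \right)^m, \qquad x\in\mathbb{R}.$$ On the complex Hilbert space $L^2(\mathbb{R})$ consider the operators, both with domain $H^1(\mathbb{R})$, $$L_+ = |\nabla| - \frac{2m}{1+x^2}, \qquad L_- = L_+ + R, \qquad (Rf)(x) = \frac{1}{2\pi}\int_{\mathbb{R}} \frac{|Q_m(x)-Q_m(y)|^2}{|x-y|^2}\, f(y)\,dy ,$$ where $|\nabla|$ is the Fourier multiplier with symbol $|\xi|$ (for the Fourier transform with kernel $e^{-\mathrm{i}x\xi}$). Let $\Pi_+$ be the orthogonal projection of $L^2(\mathbb{R})$ onto the functions whose Fourier transform vanishes on $\xi<0$, and let $\Pi_- = 1-\Pi_+$. Let $P$ be the orthogonal projection of $L^2(\mathbb{R})$ onto the closed linear span of the $L^2$-eigenfunctions of $L_+$, let $P^\perp = 1-P$, and put $$U f = Q_m\, \Pi_+ f + \overline{Q}_m\, \Pi_- f .$$ Then: 1. $U$ is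 a unitary map from $L^2(\mathbb{R})$ onto $P^\perp L^2(\mathbb{R})$, with adjoint $U^* g = \overline{Q}_m\, \Pi_+ g + Q_m\, \Pi_- g$ for $g\in P^\perp L^2(\mathbb{R})$. 2. As operators on $L^2(\mathbb{R})$, including equality of their domains, $$U^* P^\perp L_+ P^\perp U = U^* P^\perp L_- P^\perp U = |\nabla| .$$ 3. The closed linear spans of the $L^2$-eigenfunctions (bound states) of $L_+$ and of $L_-$ coincide, and $L_+$ and $L_-$ have purely absolutely continuous spectrum equal to $[0,\infty)$ on the orthogonal complement of their bound states. That is, each of them has a spectral resolution, its absolutely continuous subspace is exactly this orthogonal complement $P^\perp L^2(\mathbb{R})$, and its part in this subspace has spectrum $[0,\infty)$. -/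

import Mathlib

open MeasureTheory
open scoped ENNReal InnerProductSpace FourierTransform

noncomputable section

namespace HalfHarmonic

/-! ### Unbounded operators on a complex Hilbert space -/

section Abstract

variable {H : Type*} [NormedAddCommGroup H] [InnerProductSpace ℂ H]

/-- The composition `B A C` of a partially defined operator `A` with everywhere defined operators,
on its natural domain `{f | C f ∈ dom A}`. -/
def sandwich {H₁ H₂ : Type*} [NormedAddCommGroup H₁] [InnerProductSpace ℂ H₁]
    [NormedAddCommGroup H₂] [InnerProductSpace ℂ H₂]
    (B : H →L[ℂ] H₂) (A : H →ₗ.[ℂ] H) (C : H₁ →L[ℂ] H) : H₁ →ₗ.[ℂ] H₂ where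
  domain := A.domain.comap (C : H₁ →ₗ[ℂ] H)
  toFun :=
    { toFun := fun f => B (A ⟨C f, f.2⟩)
      map_add' := fun f g => by
        rw [← map_add, ← A.map_add]
        congr 2
        exact Subtype.ext (map_add C (f : H₁) (g : H₁))
      map_smul' := fun c f => by
        rw [RingHom.id_apply, ← map_smul, ← A.map_smul]
        congr 2
        exact Subtype.ext (map_smul C c (f : H₁)) }

/-- The closed linear span of all eigenvectors of `A` (with real eigenvalues). -/
def boundStates (A : H →ₗ.[ℂ] H) : Submodule ℂ H :=
  (Submodule.span ℂ
    {f : H | ∃ (h : f ∈ A.domain) (E : ℝ), A ⟨f, h⟩ = (E : ℂ) • f}).topologicalClosure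

instance [CompleteSpace H] (A : H →ₗ.[ℂ] H) : CompleteSpace (boundStates A) := by
  unfold boundStates; infer_instance

/-- The orthogonal projection onto the bound states of `A`. -/
def boundProj [CompleteSpace H] (A : H →ₗ.[ℂ] H) : H →L[ℂ] H :=
  (boundStates A).starProjection

/-- The part of `A` in the subspace `K`: the operator on `K` with domain
`{u ∈ K ∩ dom A | A u ∈ K}` that acts as `A`. -/
def part (A : H →ₗ.[ℂ] H) (K : Submodule ℂ H) : K →ₗ.[ℂ] K where
  domain :=
    { carrier := {u | ∃ h : (u : H) ∈ A.domain, A ⟨u, h⟩ ∈ K}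
      zero_mem' := ⟨A.domain.zero_mem, by
        have : A ⟨((0 : K) : H), A.domain.zero_mem⟩ = 0 := A.map_zero
        rw [this]; exact K.zero_mem⟩
      add_mem' := by
        rintro u v ⟨hu, hu'⟩ ⟨hv, hv'⟩
        refine ⟨A.domain.add_mem hu hv, ?_⟩
        have : A ⟨((u + v : K) : H), A.domain.add_mem hu hv⟩ = A ⟨u, hu⟩ + A ⟨v, hv⟩ :=
          A.map_add ⟨u, hu⟩ ⟨v, hv⟩
        rw [this]; exact K.add_mem hu' hv'
      smul_mem' := by
        rintro c u ⟨hu, hu'⟩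
        refine ⟨A.domain.smul_mem c hu, ?_⟩
        have : A ⟨((c • u : K) : H), A.domain.smul_mem c hu⟩ = c • A ⟨u, hu⟩ :=
          A.map_smul c ⟨u, hu⟩
        rw [this]; exact K.smul_mem c hu' }
  toFun :=
    { toFun := fun u => ⟨A ⟨u, u.2.1⟩, u.2.2⟩
      map_add' := fun u v => Subtype.ext (A.map_add ⟨u, u.2.1⟩ ⟨v, v.2.1⟩)
      map_smul' := fun c u => Subtype.ext (A.map_smul c ⟨u, u.2.1⟩) }

/-- The spectrum of an unbounded operator: the set of all `z` for which `A - z` has no bounded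
everywhere defined inverse. -/
def operatorSpectrum (A : H →ₗ.[ℂ] H) : Set ℂ :=
  {z | ¬ ∃ T : H →L[ℂ] H,
    (∀ f : H, ∃ h : T f ∈ A.domain, A ⟨T f, h⟩ - z • T f = f) ∧
    ∀ u : A.domain, T (A u - z • (u : H)) = u}

/-- A projection-valued measure on the Borel sets of `ℝ`. -/
structure ProjectionValuedMeasure (H : Type*) [NormedAddCommGroup H] [InnerProductSpace ℂ H]
    [CompleteSpace H] where
  /-- The projection attached to a set; only its values on Borel sets matter. -/
  proj : Set ℝ → H →L[ℂ] H
  isStarProjection : ∀ B, MeasurableSet B → IsStarProjection (proj B)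
  proj_empty : proj ∅ = 0
  proj_univ : proj Set.univ = 1
  proj_inter : ∀ B C, MeasurableSet B → MeasurableSet C → proj (B ∩ C) = proj B * proj C
  proj_iUnion : ∀ B : ℕ → Set ℝ, (∀ n, MeasurableSet (B n)) →
    Pairwise (Function.onFun Disjoint B) →
    ∀ f, HasSum (fun n => proj (B n) f) (proj (⋃ n, B n) f)

namespace ProjectionValuedMeasure

variable [CompleteSpace H] (E : ProjectionValuedMeasure H)

lemma inner_proj_eq (B : Set ℝ) (hB : MeasurableSet B) (f : H) :
    (⟪f, E.proj B f⟫_ℂ).re = ‖E.proj B f‖ ^ 2 := by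
  have h := E.isStarProjection B hB
  have h1 : E.proj B (E.proj B f) = E.proj B f := by
    have := h.isIdempotentElem
    exact congrArg (fun T : H →L[ℂ] H => T f) this
  have h2 : ContinuousLinearMap.adjoint (E.proj B) = E.proj B := h.isSelfAdjoint
  have h3 : ⟪E.proj B f, E.proj B f⟫_ℂ = ⟪f, E.proj B f⟫_ℂ := by
    rw [← ContinuousLinearMap.adjoint_inner_right, h2, h1]
  rw [← h3, inner_self_eq_norm_sq_to_K]
  norm_cast

/-- The scalar spectral measure `B ↦ ⟪f, E(B) f⟫ = ‖E(B) f‖ ^ 2` of the vector `f`. -/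
def scalarMeasure (f : H) : Measure ℝ :=
  Measure.ofMeasurable (fun B _ => ENNReal.ofReal (‖E.proj B f‖ ^ 2))
    (by simp [E.proj_empty])
    (by
      intro B hB hd
      have h1 := E.proj_iUnion B hB hd f
      have h2 : HasSum (fun n => ‖E.proj (B n) f‖ ^ 2) (‖E.proj (⋃ n, B n) f‖ ^ 2) := by
        have h3 := Complex.hasSum_re (h1.mapL (innerSL ℂ f))
        simp only [innerSL_apply_apply] at h3
        rw [E.inner_proj_eq _ (MeasurableSet.iUnion hB)] at h3
        simpa only [E.inner_proj_eq _ (hB _)] using h3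
      rw [← h2.tsum_eq, ENNReal.ofReal_tsum_of_nonneg (fun n => by positivity) h2.summable])

lemma scalarMeasure_apply (f : H) {B : Set ℝ} (hB : MeasurableSet B) :
    E.scalarMeasure f B = ENNReal.ofReal (‖E.proj B f‖ ^ 2) :=
  Measure.ofMeasurable_apply B hB

lemma scalarMeasure_ac_iff (f : H) :
    E.scalarMeasure f ≪ volume ↔
      ∀ B, MeasurableSet B → volume B = 0 → E.proj B f = 0 := by
  constructor
  · intro h B hB h0
    have := h h0
    rw [E.scalarMeasure_apply f hB] at this
    simpa using this
  · intro h
    refine Measure.AbsolutelyContinuous.mk fun B hB h0 => ?_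
    rw [E.scalarMeasure_apply f hB, h B hB h0]
    simp

/-- `A = ∫ t dE(t)`: the domain of `A` is `{f | ∫ t ^ 2 d⟪f, E(t) f⟫ < ∞}`, and there
`⟪f, A f⟫ = ∫ t d⟪f, E(t) f⟫`. -/
def Represents (A : H →ₗ.[ℂ] H) : Prop :=
  (∀ f : H, f ∈ A.domain ↔ ∫⁻ t, ENNReal.ofReal (t ^ 2) ∂(E.scalarMeasure f) < ∞) ∧
  ∀ f : A.domain, ⟪(f : H), A f⟫_ℂ = ((∫ t, t ∂(E.scalarMeasure f) : ℝ) : ℂ)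

/-- The absolutely continuous subspace: all vectors whose scalar spectral measure is absolutely
continuous with respect to Lebesgue measure. -/
def acSubspace : Submodule ℂ H where
  carrier := {f | E.scalarMeasure f ≪ volume}
  zero_mem' := by
    change E.scalarMeasure 0 ≪ volume
    rw [scalarMeasure_ac_iff]; intros; simp
  add_mem' := by
    intro f g hf hg
    change E.scalarMeasure (f + g) ≪ volume
    change E.scalarMeasure f ≪ volume at hf
    change E.scalarMeasure g ≪ volume at hg
    rw [scalarMeasure_ac_iff] at *
    intro B hB h0
    rw [map_add, hf B hB h0, hg B hB h0, add_zero]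
  smul_mem' := by
    intro c f hf
    change E.scalarMeasure (c • f) ≪ volume
    change E.scalarMeasure f ≪ volume at hf
    rw [scalarMeasure_ac_iff] at *
    intro B hB h0
    rw [map_smul, hf B hB h0, smul_zero]

end ProjectionValuedMeasure

/-- `A` has a spectral resolution `E` (hence is self-adjoint, and `E` is unique), its absolutely
continuous subspace is the whole orthogonal complement of its bound states, and the spectrum of the
part of `A` in this complement is `S`. -/
def HasPurelyACSpectrumOffBoundStates [CompleteSpace H] (A : H →ₗ.[ℂ] H) (S : Set ℝ) : Prop :=
  ∃ E : ProjectionValuedMeasure H, E.Represents A ∧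
    E.acSubspace = (boundStates A)ᗮ ∧
    operatorSpectrum (part A (boundStates A)ᗮ) = Complex.ofReal '' S

end Abstract

/-! ### Multiplication operators, Fourier projections and `|∇|` on `L²(ℝ)` -/

/-- The complex Hilbert space `L²(ℝ)`. -/
abbrev L2 : Type := Lp ℂ 2 (volume : Measure ℝ)

/-- Multiplication by a function `q`, with its maximal domain `{f ∈ L² | q f ∈ L²}`. -/
def mulOp (q : ℝ → ℂ) : L2 →ₗ.[ℂ] L2 where
  domain :=
    { carrier := {f | MemLp (fun x => q x * f x) 2 volume}
      zero_mem' := by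
        have h : (fun x => q x * (0 : L2) x) =ᵐ[volume] fun _ => (0 : ℂ) := by
          filter_upwards [Lp.coeFn_zero ℂ 2 (volume : Measure ℝ)] with x hx
          rw [hx]; simp
        exact (memLp_congr_ae h).2 MemLp.zero
      add_mem' := by
        intro f g hf hg
        have h : (fun x => q x * (f + g) x) =ᵐ[volume]
            (fun x => q x * f x) + fun x => q x * g x := by
          filter_upwards [Lp.coeFn_add f g] with x hx
          rw [hx]; simp [mul_add]
        exact (memLp_congr_ae h).2 (hf.add hg)
      smul_mem' := by
        intro c f hf
        have h : (fun x => q x * (c • f) x) =ᵐ[volume] c • fun x => q x * f x := by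
          filter_upwards [Lp.coeFn_smul c f] with x hx
          rw [hx]; simp [mul_left_comm]
        exact (memLp_congr_ae h).2 (hf.const_smul c) }
  toFun :=
    { toFun := fun f => MemLp.toLp (fun x => q x * (f : L2) x) f.2
      map_add' := by
        intro f g
        rw [← MemLp.toLp_add]
        refine MemLp.toLp_congr _ _ ?_
        filter_upwards [Lp.coeFn_add (f : L2) g] with x hx
        simp only [Submodule.coe_add, hx, Pi.add_apply, mul_add]
      map_smul' := by
        intro c f
        rw [RingHom.id_apply, ← MemLp.toLp_const_smul]
        refine MemLp.toLp_congr _ _ ?_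
        filter_upwards [Lp.coeFn_smul c (f : L2)] with x hx
        simp only [Submodule.coe_smul, hx, Pi.smul_apply, smul_eq_mul, mul_left_comm] }

/-- Multiplication by a bounded measurable function, as a bounded operator. -/
def mulBdd (q : ℝ → ℂ) (hq : Measurable q) (C : ℝ) (hC : ∀ x, ‖q x‖ ≤ C) : L2 →L[ℂ] L2 :=
  have hmem : ∀ f : L2, MemLp (fun x => q x * f x) 2 volume := fun f =>
    (Lp.memLp f).of_le_mul (hq.aestronglyMeasurable.mul (Lp.aestronglyMeasurable f))
      (Filter.Eventually.of_forall fun x => by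
        rw [norm_mul]; exact mul_le_mul_of_nonneg_right (hC x) (norm_nonneg _))
  LinearMap.mkContinuous
    { toFun := fun f => mulOp q ⟨f, hmem f⟩
      map_add' := fun f g => (mulOp q).map_add ⟨f, hmem f⟩ ⟨g, hmem g⟩
      map_smul' := fun c f => (mulOp q).map_smul c ⟨f, hmem f⟩ } C
    (fun f => by
      refine Lp.norm_le_mul_norm_of_ae_le_mul ?_
      have h : (mulOp q ⟨f, hmem f⟩ : L2) =ᵐ[volume] fun x => q x * f x :=
        MemLp.coeFn_toLp (hmem f)
      filter_upwards [h] with x hx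
      change ‖(mulOp q ⟨f, hmem f⟩ : L2) x‖ ≤ _
      rw [hx, norm_mul]
      exact mul_le_mul_of_nonneg_right (hC x) (norm_nonneg _))

/-- The Fourier transform on `L²(ℝ)`, normalized by `exp (-2 π i x ξ)`. -/
def fourierL2 : L2 ≃ₗᵢ[ℂ] L2 := Lp.fourierTransformₗᵢ ℝ ℂ

/-- The operator `|∇|`: the Fourier multiplier with symbol `2 π |ξ|`, with domain
`H¹(ℝ) = {f ∈ L² | |ξ| 𝓕 f ∈ L²}`. -/
def absNabla : L2 →ₗ.[ℂ] L2 :=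
  sandwich (fourierL2.symm.toContinuousLinearEquiv : L2 →L[ℂ] L2)
    (mulOp fun ξ => ((2 * Real.pi * |ξ| : ℝ) : ℂ))
    (fourierL2.toContinuousLinearEquiv : L2 →L[ℂ] L2)

/-- The projection `Π₊` onto nonnegative Fourier frequencies. -/
def projPos : L2 →L[ℂ] L2 :=
  (fourierL2.symm.toContinuousLinearEquiv : L2 →L[ℂ] L2) ∘L
    mulBdd (Set.indicator (Set.Ici 0) 1) (measurable_one.indicator measurableSet_Ici) 1
      (fun x => (norm_indicator_le_norm_self _ x).trans (by simp)) ∘L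
    (fourierL2.toContinuousLinearEquiv : L2 →L[ℂ] L2)

/-- The projection `Π₋ = 1 - Π₊` onto negative Fourier frequencies. -/
def projNeg : L2 →L[ℂ] L2 := 1 - projPos

/-! ### The half-harmonic map `Q_m` and the gauge transform -/

/-- `Q_m(x) = (i (x - i) / (x + i)) ^ m`. -/
def Q (m : ℕ) (x : ℝ) : ℂ :=
  (Complex.I * (((x : ℂ) - Complex.I) / ((x : ℂ) + Complex.I))) ^ m

lemma add_I_ne_zero (x : ℝ) : (x : ℂ) + Complex.I ≠ 0 := by
  intro h
  have := congrArg Complex.im h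
  simp at this

lemma norm_add_I_sq (x : ℝ) : ‖(x : ℂ) + Complex.I‖ ^ 2 = 1 + x ^ 2 := by
  rw [← Complex.normSq_eq_norm_sq, Complex.normSq_apply]
  simp; ring

lemma norm_sub_I (x : ℝ) : ‖(x : ℂ) - Complex.I‖ = ‖(x : ℂ) + Complex.I‖ := by
  rw [← Complex.norm_conj ((x : ℂ) + Complex.I)]
  simp [sub_eq_add_neg]

lemma norm_Q_one (x : ℝ) :
    ‖Complex.I * (((x : ℂ) - Complex.I) / ((x : ℂ) + Complex.I))‖ = 1 := by
  rw [norm_mul, norm_div, norm_sub_I, Complex.norm_I, one_mul,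
    div_self (norm_ne_zero_iff.2 (add_I_ne_zero x))]

lemma norm_Q (m : ℕ) (x : ℝ) : ‖Q m x‖ = 1 := by
  rw [Q, norm_pow, norm_Q_one, one_pow]

lemma measurable_Q (m : ℕ) : Measurable (Q m) := by
  unfold Q; fun_prop

/-- Multiplication by `Q_m`. -/
def mulQ (m : ℕ) : L2 →L[ℂ] L2 :=
  mulBdd (Q m) (measurable_Q m) 1 (fun x => (norm_Q m x).le)

/-- Multiplication by the complex conjugate of `Q_m`. -/
def mulQConj (m : ℕ) : L2 →L[ℂ] L2 :=
  mulBdd (fun x => (starRingEnd ℂ) (Q m x))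
    (Complex.continuous_conj.measurable.comp (measurable_Q m)) 1
    (fun x => by rw [Complex.norm_conj, norm_Q])

/-- The gauge transform `U f = Q_m Π₊ f + conj Q_m Π₋ f`, as an operator on `L²(ℝ)`. -/
def gaugeU (m : ℕ) : L2 →L[ℂ] L2 := mulQ m ∘L projPos + mulQConj m ∘L projNeg

/-! ### The operators `L₊` and `L₋` -/

/-- The potential `2 m / (1 + x ^ 2)`, as a bounded multiplication operator. -/
def potential (m : ℕ) : L2 →L[ℂ] L2 :=
  mulBdd (fun x => ((2 * m / (1 + x ^ 2) : ℝ) : ℂ)) (by fun_prop) (2 * m) (fun x => by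
    have h : (0 : ℝ) < 1 + x ^ 2 := by positivity
    rw [Complex.norm_real, Real.norm_of_nonneg (by positivity), div_le_iff₀ h]
    nlinarith [sq_nonneg x, (Nat.cast_nonneg m : (0 : ℝ) ≤ m),
      mul_nonneg (Nat.cast_nonneg m : (0 : ℝ) ≤ m) (sq_nonneg x)])

/-- The kernel `|Q_m(x) - Q_m(y)|² / (2 π |x - y|²)` of `R`. -/
def kernelR (m : ℕ) (x y : ℝ) : ℝ := ‖Q m x - Q m y‖ ^ 2 / (2 * Real.pi * |x - y| ^ 2)

lemma norm_pow_sub_pow_le_of_norm_one (a b : ℂ) (ha : ‖a‖ = 1) (hb : ‖b‖ = 1) (m : ℕ) :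
    ‖a ^ m - b ^ m‖ ≤ m * ‖a - b‖ := by
  induction m with
  | zero => simp
  | succ k ih =>
    have h : a ^ (k + 1) - b ^ (k + 1) = a * (a ^ k - b ^ k) + (a - b) * b ^ k := by ring
    rw [h]
    refine (norm_add_le _ _).trans ?_
    rw [norm_mul, norm_mul, norm_pow, ha, hb, one_pow]
    push_cast
    linarith

lemma norm_Q_sub_sq_le (m : ℕ) (x y : ℝ) :
    ‖Q m x - Q m y‖ ^ 2 ≤ 4 * m ^ 2 * |x - y| ^ 2 / ((1 + x ^ 2) * (1 + y ^ 2)) := by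
  have h0 := norm_pow_sub_pow_le_of_norm_one _ _ (norm_Q_one x) (norm_Q_one y) m
  have h1 : Complex.I * (((x : ℂ) - Complex.I) / ((x : ℂ) + Complex.I)) -
      Complex.I * (((y : ℂ) - Complex.I) / ((y : ℂ) + Complex.I)) =
      (-2 * ((x - y : ℝ) : ℂ)) / (((x : ℂ) + Complex.I) * ((y : ℂ) + Complex.I)) := by
    have hx := add_I_ne_zero x
    have hy := add_I_ne_zero y
    field_simp
    push_cast
    ring_nf
    simp only [Complex.I_sq]
    ring
  have h2 : ‖Complex.I * (((x : ℂ) - Complex.I) / ((x : ℂ) + Complex.I)) -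
      Complex.I * (((y : ℂ) - Complex.I) / ((y : ℂ) + Complex.I))‖ ^ 2 =
      4 * |x - y| ^ 2 / ((1 + x ^ 2) * (1 + y ^ 2)) := by
    rw [h1, norm_div, norm_mul, norm_mul, Complex.norm_real, div_pow, mul_pow, mul_pow,
      norm_add_I_sq, norm_add_I_sq, Real.norm_eq_abs]
    norm_num
  calc ‖Q m x - Q m y‖ ^ 2 ≤ _ := pow_le_pow_left₀ (norm_nonneg _) h0 2
    _ = _ := by rw [mul_pow, h2]; ring

lemma kernelR_nonneg (m : ℕ) (x y : ℝ) : 0 ≤ kernelR m x y := by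
  unfold kernelR
  have := Real.pi_pos
  positivity

lemma kernelR_le (m : ℕ) (x y : ℝ) :
    kernelR m x y ≤ 4 * m ^ 2 * ((1 + x ^ 2)⁻¹ * (1 + y ^ 2)⁻¹) := by
  unfold kernelR
  have hpi := Real.pi_gt_three
  have hx : (0 : ℝ) < 1 + x ^ 2 := by positivity
  have hy : (0 : ℝ) < 1 + y ^ 2 := by positivity
  have hR : (0 : ℝ) ≤ 4 * m ^ 2 * ((1 + x ^ 2)⁻¹ * (1 + y ^ 2)⁻¹) := by positivity
  rcases eq_or_ne x y with h | h
  · subst h; simpa using hR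
  · have hd : 0 < |x - y| ^ 2 := by
      have := abs_pos.2 (sub_ne_zero.2 h); positivity
    rw [div_le_iff₀ (by positivity)]
    refine (norm_Q_sub_sq_le m x y).trans ?_
    have h1 : 4 * (m : ℝ) ^ 2 * |x - y| ^ 2 / ((1 + x ^ 2) * (1 + y ^ 2)) =
        (4 * m ^ 2 * ((1 + x ^ 2)⁻¹ * (1 + y ^ 2)⁻¹)) * |x - y| ^ 2 := by
      field_simp
    rw [h1]
    refine mul_le_mul_of_nonneg_left ?_ hR
    nlinarith

lemma measurable_kernelR (m : ℕ) : Measurable (fun p : ℝ × ℝ => kernelR m p.1 p.2) := by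
  unfold kernelR
  have h1 : Measurable (fun p : ℝ × ℝ => Q m p.1) := (measurable_Q m).comp measurable_fst
  have h2 : Measurable (fun p : ℝ × ℝ => Q m p.2) := (measurable_Q m).comp measurable_snd
  exact ((h1.sub h2).norm.pow_const 2).div (by fun_prop)

lemma memLp_weight : MemLp (fun x : ℝ => (1 + x ^ 2)⁻¹) 2 volume := by
  have hm : Measurable (fun x : ℝ => (1 + x ^ 2)⁻¹) := by fun_prop
  rw [memLp_two_iff_integrable_sq hm.aestronglyMeasurable]
  refine integrable_inv_one_add_sq.mono (hm.pow_const 2).aestronglyMeasurable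
    (Filter.Eventually.of_forall fun x => ?_)
  have h1 : (1 + x ^ 2)⁻¹ ≤ 1 := inv_le_one_of_one_le₀ (by nlinarith [sq_nonneg x])
  have h0 : (0 : ℝ) ≤ (1 + x ^ 2)⁻¹ := by positivity
  rw [Real.norm_of_nonneg (by positivity), Real.norm_of_nonneg h0]
  nlinarith

lemma integrable_weight_mul (f : L2) : Integrable (fun y => (1 + y ^ 2)⁻¹ * ‖f y‖) volume :=
  memLp_weight.integrable_mul (Lp.memLp f).norm

lemma integrable_kernelR_mul (m : ℕ) (f : L2) (x : ℝ) :
    Integrable (fun y => (kernelR m x y : ℂ) * f y) volume := by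
  have hk : Measurable (fun y => kernelR m x y) :=
    Measurable.of_uncurry_left (f := fun a b => kernelR m a b) (measurable_kernelR m)
  have hk' : Measurable (fun y => (kernelR m x y : ℂ)) := Complex.measurable_ofReal.comp hk
  have hf : AEStronglyMeasurable (fun y => f y) volume := Lp.aestronglyMeasurable f
  have hI : Integrable (fun y => (4 * (m : ℝ) ^ 2 * (1 + x ^ 2)⁻¹) * ((1 + y ^ 2)⁻¹ * ‖f y‖))
      volume := (integrable_weight_mul f).const_mul _
  have hm : AEStronglyMeasurable (fun y => (kernelR m x y : ℂ) * f y) volume :=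
    hk'.aestronglyMeasurable.mul hf
  refine hI.mono' hm (Filter.Eventually.of_forall fun y => ?_)
  rw [norm_mul, Complex.norm_real, Real.norm_of_nonneg (kernelR_nonneg m x y), ← mul_assoc]
  exact mul_le_mul_of_nonneg_right ((kernelR_le m x y).trans (le_of_eq (by ring)))
    (norm_nonneg _)

/-- The integral operator `R` on functions. -/
def integralR (m : ℕ) (f : L2) (x : ℝ) : ℂ := ∫ y, (kernelR m x y : ℂ) * f y

lemma memLp_integralR (m : ℕ) (f : L2) : MemLp (integralR m f) 2 volume := by
  have hmeas : StronglyMeasurable (integralR m f) := by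
    have h : StronglyMeasurable
        (fun p : ℝ × ℝ => (kernelR m p.1 p.2 : ℂ) * f p.2) :=
      (Complex.measurable_ofReal.comp (measurable_kernelR m)).stronglyMeasurable.mul
        ((Lp.stronglyMeasurable f).comp_measurable measurable_snd)
    exact h.integral_prod_right
  refine (memLp_weight.const_mul (4 * m ^ 2 * ∫ y, (1 + y ^ 2)⁻¹ * ‖f y‖)).mono
    hmeas.aestronglyMeasurable (Filter.Eventually.of_forall fun x => ?_)
  have hI : 0 ≤ ∫ y, (1 + y ^ 2)⁻¹ * ‖f y‖ := integral_nonneg fun y => by positivity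
  have hx : (0 : ℝ) < 1 + x ^ 2 := by positivity
  rw [Real.norm_of_nonneg (by positivity)]
  refine (norm_integral_le_integral_norm _).trans ?_
  calc ∫ y, ‖(kernelR m x y : ℂ) * f y‖
      ≤ ∫ y, (4 * m ^ 2 * (1 + x ^ 2)⁻¹) * ((1 + y ^ 2)⁻¹ * ‖f y‖) := by
        refine integral_mono (integrable_kernelR_mul m f x).norm
          ((integrable_weight_mul f).const_mul _) fun y => ?_
        simp only [norm_mul, Complex.norm_real]
        rw [Real.norm_of_nonneg (kernelR_nonneg m x y), ← mul_assoc]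
        exact mul_le_mul_of_nonneg_right ((kernelR_le m x y).trans (le_of_eq (by ring)))
          (norm_nonneg _)
    _ = _ := by rw [integral_const_mul]; ring

/-- The integral operator `R` on `L²(ℝ)`. -/
def opR (m : ℕ) : L2 →ₗ[ℂ] L2 where
  toFun f := (memLp_integralR m f).toLp (integralR m f)
  map_add' f g := by
    rw [← MemLp.toLp_add]
    refine MemLp.toLp_congr _ _ (Filter.Eventually.of_forall fun x => ?_)
    rw [Pi.add_apply]
    unfold integralR
    rw [← integral_add (integrable_kernelR_mul m f x) (integrable_kernelR_mul m g x)]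
    refine integral_congr_ae ?_
    filter_upwards [Lp.coeFn_add f g] with y hy
    rw [hy, Pi.add_apply, mul_add]
  map_smul' c f := by
    rw [RingHom.id_apply, ← MemLp.toLp_const_smul]
    refine MemLp.toLp_congr _ _ (Filter.Eventually.of_forall fun x => ?_)
    rw [Pi.smul_apply]
    unfold integralR
    rw [← integral_smul]
    refine integral_congr_ae ?_
    filter_upwards [Lp.coeFn_smul c f] with y hy
    rw [hy, Pi.smul_apply, smul_eq_mul, smul_eq_mul, mul_left_comm]

/-- `L₊ = |∇| - 2 m / (1 + x ^ 2)` with domain `H¹(ℝ)`. -/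
def Lplus (m : ℕ) : L2 →ₗ.[ℂ] L2 where
  domain := absNabla.domain
  toFun := absNabla.toFun - (potential m : L2 →ₗ[ℂ] L2) ∘ₗ absNabla.domain.subtype

/-- `L₋ = L₊ + R` with domain `H¹(ℝ)`. -/
def Lminus (m : ℕ) : L2 →ₗ.[ℂ] L2 where
  domain := (Lplus m).domain
  toFun := (Lplus m).toFun + opR m ∘ₗ (Lplus m).domain.subtype

/-- `P^⊥ = 1 - P`, where `P` is the orthogonal projection onto the span of the
`L²`-eigenfunctions of `L₊`. -/
def Pperp (m : ℕ) : L2 →L[ℂ] L2 := 1 - boundProj (Lplus m)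

end HalfHarmonic

end

open HalfHarmonic ContinuousLinearMap

/-!
`Q_m` is inner: `|Q_m| = 1` on the line and multiplication by `Q_m` preserves the Hardy space `H²`.
So `U` multiplies the two orthogonal halves `H²` and `(H²)ᗮ` of `L²(ℝ)` by unimodular functions
without mixing them, hence is an isometry. On these halves `|∇|` is `-i ∂` and `i ∂`, and the
derivative of `Q_m` produces exactly the potential: `L₊ U = U |∇|`. The complement of the range of
`U` is `conj Q_m` times the model space of `Q_{2m}`, a finite-dimensional space of rational
functions in `H¹(ℝ)`. The kernel of `R` is a finite sum of products `φ(x) conj φ(y)` with `φ` in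
that complement, so `R U = 0` and also `L₋ U = U |∇|`. By symmetry `L₊` and `L₋` preserve the
complement of the range of `U`, which is therefore spanned by eigenvectors, while on the range they
are unitarily equivalent to multiplication by `2 π |ξ|`.
-/

noncomputable section

namespace HalfHarmonic

section OperatorTheory

variable {H K : Type*} [NormedAddCommGroup H] [InnerProductSpace ℂ H]
  [NormedAddCommGroup K] [InnerProductSpace ℂ K]

/-! ### Graphs and spectra of partially defined operators -/

lemma isFormalAdjoint_self_iff {A : H →ₗ.[ℂ] H} :
    A.IsFormalAdjoint A ↔
      ∀ f f' g g', (f, f') ∈ A.graph → (g, g') ∈ A.graph → ⟪f', g⟫_ℂ = ⟪f, g'⟫_ℂ := by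
  refine ⟨?_, fun h f g => h _ _ _ _ (A.mem_graph f) (A.mem_graph g)⟩
  intro h f f' g g' hf hg
  obtain ⟨f, rfl, rfl⟩ := A.mem_graph_iff.1 hf
  obtain ⟨g, rfl, rfl⟩ := A.mem_graph_iff.1 hg
  exact h f g

lemma mem_graph_part {A : H →ₗ.[ℂ] H} {S : Submodule ℂ H} {f g : S} :
    (f, g) ∈ (part A S).graph ↔ ((f : H), (g : H)) ∈ A.graph := by
  constructor
  · intro h
    obtain ⟨u, rfl, rfl⟩ := (part A S).mem_graph_iff.1 h
    exact A.mem_graph ⟨u, u.2.1⟩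
  · intro h
    obtain ⟨u, hu, hAu⟩ := A.mem_graph_iff.1 h
    obtain ⟨u, hu'⟩ := u
    subst hu
    exact (part A S).mem_graph_iff.2 ⟨⟨f, hu', hAu ▸ g.2⟩, rfl, Subtype.ext hAu⟩

lemma isFormalAdjoint_part {A : H →ₗ.[ℂ] H} (hA : A.IsFormalAdjoint A) (S : Submodule ℂ H) :
    (part A S).IsFormalAdjoint (part A S) := by
  rw [isFormalAdjoint_self_iff] at hA ⊢
  intro f f' g g' hf hg
  exact hA f f' g g' (mem_graph_part.1 hf) (mem_graph_part.1 hg)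

lemma mem_graph_sandwich_iff (B : H →L[ℂ] K) (A : H →ₗ.[ℂ] H) (C : K →L[ℂ] H) {f g : K} :
    (f, g) ∈ (sandwich B A C).graph ↔ ∃ h, (C f, h) ∈ A.graph ∧ B h = g := by
  constructor
  · intro h
    obtain ⟨u, rfl, rfl⟩ := (sandwich B A C).mem_graph_iff.1 h
    exact ⟨_, A.mem_graph ⟨C u, u.2⟩, rfl⟩
  · rintro ⟨h, hh, rfl⟩
    have hf : C f ∈ A.domain := A.mem_domain_of_mem_graph hh
    rw [A.mem_graph_snd_inj hh (A.mem_graph ⟨C f, hf⟩) rfl]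
    exact (sandwich B A C).mem_graph ⟨f, hf⟩

lemma notMem_operatorSpectrum_iff {A : H →ₗ.[ℂ] H} {z : ℂ} :
    z ∉ operatorSpectrum A ↔ ∃ T : H →L[ℂ] H,
      (∀ f, (T f, f + z • T f) ∈ A.graph) ∧ ∀ u g, (u, g) ∈ A.graph → T (g - z • u) = u := by
  rw [operatorSpectrum, Set.mem_ofPred_eq, not_not]
  refine exists_congr fun T => and_congr (forall_congr' fun f => ?_) ?_
  · simp only [LinearPMap.mem_graph_iff, Subtype.exists, exists_and_left, sub_eq_iff_eq_add,
      exists_eq_left]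
  · constructor
    · intro h u g hu
      obtain ⟨u, rfl, rfl⟩ := A.mem_graph_iff.1 hu
      exact h u
    · exact fun h u => h u (A u) (A.mem_graph u)

lemma operatorSpectrum_eq_of_mem_graph_iff (e : K ≃ₗᵢ[ℂ] H) {A₀ : K →ₗ.[ℂ] K} {A : H →ₗ.[ℂ] H}
    (h : ∀ u g, (u, g) ∈ A₀.graph ↔ (e u, e g) ∈ A.graph) :
    operatorSpectrum A = operatorSpectrum A₀ := by
  refine compl_injective (Set.ext fun z => ?_)
  simp only [Set.mem_compl_iff, notMem_operatorSpectrum_iff]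
  constructor
  · rintro ⟨T, hT, hT'⟩
    refine ⟨(e.symm.toContinuousLinearEquiv : H →L[ℂ] K) ∘L T ∘L
      (e.toContinuousLinearEquiv : K →L[ℂ] H), fun f => ?_, fun u g hu => ?_⟩
    · rw [h]; simpa using hT (e f)
    · simpa using congrArg e.symm (hT' _ _ ((h u g).1 hu))
  · rintro ⟨T, hT, hT'⟩
    refine ⟨(e.toContinuousLinearEquiv : K →L[ℂ] H) ∘L T ∘L
      (e.symm.toContinuousLinearEquiv : H →L[ℂ] K), fun f => ?_, fun u g hu => ?_⟩
    · simpa using (h _ _).1 (hT (e.symm f))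
    · have hu' : (e.symm u, e.symm g) ∈ A₀.graph := by simpa [h] using hu
      simpa using congrArg e (hT' _ _ hu')

lemma exists_orthonormalBasis_eigenvectors [FiniteDimensional ℂ H] {A : H →ₗ.[ℂ] H}
    (hA : A.IsFormalAdjoint A) (hdom : A.domain = ⊤) :
    ∃ (b : OrthonormalBasis (Fin (Module.finrank ℂ H)) ℂ H) (μ : Fin (Module.finrank ℂ H) → ℝ),
      ∀ i, (b i, (μ i : ℂ) • b i) ∈ A.graph := by
  have hmem : ∀ f, f ∈ A.domain := fun f => hdom ▸ Submodule.mem_top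
  let T : H →ₗ[ℂ] H := A.toFun ∘ₗ LinearMap.codRestrict A.domain LinearMap.id hmem
  have hT : T.IsSymmetric := fun f g => hA ⟨f, hmem f⟩ ⟨g, hmem g⟩
  refine ⟨hT.eigenvectorBasis rfl, hT.eigenvalues rfl, fun i => A.mem_graph_iff.2
    ⟨⟨_, hmem _⟩, rfl, hT.apply_eigenvectorBasis rfl i⟩⟩

lemma repr_eq_mul_of_mem_graph {ι : Type*} [Fintype ι] {A : H →ₗ.[ℂ] H}
    {b : OrthonormalBasis ι ℂ H} {μ : ι → ℝ} (hb : ∀ i, (b i, (μ i : ℂ) • b i) ∈ A.graph)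
    {f g : H} (hfg : (f, g) ∈ A.graph) (i : ι) : b.repr g i = μ i * b.repr f i := by
  have hsum : (f, ∑ j, b.repr f j • (μ j : ℂ) • b j) ∈ A.graph := by
    convert A.graph.sum_mem fun j (_ : j ∈ Finset.univ) => A.graph.smul_mem (b.repr f j) (hb j)
    · simp [Prod.fst_sum, b.sum_repr]
    · simp [Prod.snd_sum]
  rw [A.mem_graph_snd_inj hfg hsum rfl]
  classical
  simp only [map_sum, map_smul, b.repr_self, PiLp.smul_apply, WithLp.ofLp_sum, Finset.sum_apply,
    smul_eq_mul, PiLp.single_apply, mul_ite, mul_one, mul_zero, Finset.sum_ite_eq,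
    Finset.mem_univ, if_true]
  exact mul_comm _ _

/-! ### Projection-valued measures -/

namespace ProjectionValuedMeasure

variable [CompleteSpace H]

lemma mem_acSubspace_iff (E : ProjectionValuedMeasure H) {f : H} :
    f ∈ E.acSubspace ↔ ∀ B, MeasurableSet B → volume B = 0 → E.proj B f = 0 :=
  E.scalarMeasure_ac_iff f

lemma scalarMeasure_univ (E : ProjectionValuedMeasure H) (f : H) :
    E.scalarMeasure f Set.univ = ENNReal.ofReal (‖f‖ ^ 2) := by
  rw [E.scalarMeasure_apply f MeasurableSet.univ, E.proj_univ, one_def, id_apply]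

instance (E : ProjectionValuedMeasure H) (f : H) : IsFiniteMeasure (E.scalarMeasure f) :=
  ⟨by rw [E.scalarMeasure_univ]; exact ENNReal.ofReal_lt_top⟩

lemma integrable_id_scalarMeasure (E : ProjectionValuedMeasure H) {f : H}
    (hf : ∫⁻ t, ENNReal.ofReal (t ^ 2) ∂(E.scalarMeasure f) < ∞) :
    Integrable (fun t : ℝ => t) (E.scalarMeasure f) := by
  have hsq : Integrable (fun t : ℝ => t ^ 2) (E.scalarMeasure f) :=
    (lintegral_ofReal_ne_top_iff_integrable (by fun_prop) (.of_forall fun t => sq_nonneg t)).1 hf.ne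
  exact ((memLp_two_iff_integrable_sq (by fun_prop)).2 hsq).integrable one_le_two

end ProjectionValuedMeasure

section Diagonal

variable {ι : Type*} [Fintype ι]

/-- The diagonal operator that multiplies `b i` by `1` if `μ i ∈ B` and by `0` otherwise. -/
def diagProj (b : OrthonormalBasis ι ℂ H) (μ : ι → ℝ) (B : Set ℝ) : H →L[ℂ] H :=
  ∑ i, B.indicator (1 : ℝ → ℂ) (μ i) • InnerProductSpace.rankOne ℂ (b i) (b i)

lemma repr_diagProj (b : OrthonormalBasis ι ℂ H) (μ : ι → ℝ) (B : Set ℝ) (f : H) (i : ι) :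
    b.repr (diagProj b μ B f) i = B.indicator (1 : ℝ → ℂ) (μ i) * b.repr f i := by
  classical
  simp [diagProj, b.repr_apply_apply, Pi.single_apply]

lemma ext_repr (b : OrthonormalBasis ι ℂ H) {f g : H} (h : ∀ i, b.repr f i = b.repr g i) : f = g :=
  b.repr.injective (PiLp.ext h)

lemma diagProj_inter (b : OrthonormalBasis ι ℂ H) (μ : ι → ℝ) (B C : Set ℝ) :
    diagProj b μ (B ∩ C) = diagProj b μ B * diagProj b μ C := by
  refine ContinuousLinearMap.ext fun f => ext_repr b fun i => ?_
  rw [mul_def, comp_apply, repr_diagProj, repr_diagProj, repr_diagProj, ← mul_assoc,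
    Set.inter_indicator_one, Pi.mul_apply]

lemma isStarProjection_diagProj [CompleteSpace H] (b : OrthonormalBasis ι ℂ H) (μ : ι → ℝ)
    (B : Set ℝ) : IsStarProjection (diagProj b μ B) where
  isIdempotentElem := by rw [IsIdempotentElem, ← diagProj_inter, Set.inter_self]
  isSelfAdjoint := by
    rw [isSelfAdjoint_iff_isSymmetric]
    intro f g
    have hconj : ∀ t, starRingEnd ℂ (B.indicator (1 : ℝ → ℂ) t) = B.indicator 1 t := fun t => by
      by_cases ht : t ∈ B <;> simp [ht]
    simp only [coe_coe, ← b.repr.inner_map_map, PiLp.inner_apply, RCLike.inner_apply,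
      repr_diagProj, map_mul, hconj, mul_left_comm, mul_assoc]

lemma hasSum_indicator_iUnion {B : ℕ → Set ℝ} (hd : Pairwise (Function.onFun Disjoint B)) (t : ℝ) :
    HasSum (fun n => (B n).indicator (1 : ℝ → ℂ) t) ((⋃ n, B n).indicator 1 t) := by
  by_cases h : t ∈ ⋃ n, B n
  · obtain ⟨n, hn⟩ := Set.mem_iUnion.1 h
    rw [Set.indicator_of_mem h, ← Set.indicator_of_mem hn (1 : ℝ → ℂ)]
    exact hasSum_single n fun k hk =>
      Set.indicator_of_notMem (Set.disjoint_right.1 (hd hk) hn) _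
  · rw [Set.indicator_of_notMem h]
    convert hasSum_zero using 2 with n
    exact Set.indicator_of_notMem (fun hn => h (Set.mem_iUnion.2 ⟨n, hn⟩)) _

/-- The spectral resolution of the operator that multiplies `b i` by `μ i`. -/
def diagPVM [CompleteSpace H] (b : OrthonormalBasis ι ℂ H) (μ : ι → ℝ) :
    ProjectionValuedMeasure H where
  proj := diagProj b μ
  isStarProjection B _ := isStarProjection_diagProj b μ B
  proj_empty := by simp [diagProj]
  proj_univ := ContinuousLinearMap.ext fun f => ext_repr b fun i => by simp [repr_diagProj]
  proj_inter B C _ _ := diagProj_inter b μ B C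
  proj_iUnion B _ hd f := by
    simp only [diagProj, sum_apply, smul_apply]
    exact hasSum_sum fun i _ => (hasSum_indicator_iUnion hd (μ i)).smul_const _

variable [CompleteSpace H] (b : OrthonormalBasis ι ℂ H) (μ : ι → ℝ)

lemma scalarMeasure_diagPVM (f : H) : (diagPVM b μ).scalarMeasure f =
    ∑ i, ENNReal.ofReal (‖b.repr f i‖ ^ 2) • Measure.dirac (μ i) := by
  refine Measure.ext fun B hB => ?_
  rw [(diagPVM b μ).scalarMeasure_apply f hB, ← b.repr.norm_map, EuclideanSpace.norm_sq_eq,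
    ENNReal.ofReal_sum_of_nonneg fun i _ => by positivity, Measure.finsetSum_apply]
  refine Finset.sum_congr rfl fun i _ => ?_
  change ENNReal.ofReal (‖b.repr (diagProj b μ B f) i‖ ^ 2) = _
  rw [repr_diagProj, Measure.smul_apply, Measure.dirac_apply' _ hB]
  by_cases h : μ i ∈ B <;> simp [h]

lemma acSubspace_diagPVM : (diagPVM b μ).acSubspace = ⊥ := by
  refine (Submodule.eq_bot_iff _).2 fun f hf => ext_repr b fun i => ?_
  have h := (diagPVM b μ).mem_acSubspace_iff.1 hf {μ i} (measurableSet_singleton _) (by simp)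
  have hi := congrArg (fun g => b.repr g i) h
  change b.repr (diagProj b μ {μ i} f) i = _ at hi
  simpa [repr_diagProj] using hi

lemma diagPVM_represents {A : H →ₗ.[ℂ] H} {b : OrthonormalBasis ι ℂ H} {μ : ι → ℝ}
    (hb : ∀ i, (b i, (μ i : ℂ) • b i) ∈ A.graph) (hdom : A.domain = ⊤) :
    (diagPVM b μ).Represents A := by
  constructor
  · intro f
    simp only [hdom, Submodule.mem_top, true_iff, scalarMeasure_diagPVM]
    rw [lintegral_finsetSum_measure]
    refine ENNReal.sum_lt_top.2 fun i _ => ?_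
    rw [lintegral_smul_measure, lintegral_dirac]
    exact ENNReal.mul_lt_top ENNReal.ofReal_lt_top ENNReal.ofReal_lt_top
  · intro f
    have hint : ∀ i, Integrable (fun t : ℝ => t)
        (ENNReal.ofReal (‖b.repr f i‖ ^ 2) • Measure.dirac (μ i)) := fun i =>
      (integrable_dirac (by simp)).smul_measure ENNReal.ofReal_ne_top
    rw [scalarMeasure_diagPVM, integral_finsetSum_measure fun i _ => hint i, ← b.repr.inner_map_map,
      PiLp.inner_apply, Complex.ofReal_sum]
    refine Finset.sum_congr rfl fun i _ => ?_
    rw [repr_eq_mul_of_mem_graph hb (A.mem_graph f), integral_smul_measure, integral_dirac,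
      ENNReal.toReal_ofReal (by positivity), RCLike.inner_apply, mul_assoc, Complex.mul_conj,
      Complex.normSq_eq_norm_sq]
    push_cast
    simp [mul_comm]

end Diagonal

/-! ### Isometries and orthogonal sums of spectral resolutions -/

/-- The orthogonal complement of the range of an isometry. -/
abbrev rangePerp (W : K →ₗᵢ[ℂ] H) : Submodule ℂ H := (LinearMap.range W.toLinearMap)ᗮ

lemma mem_rangePerp_iff {W : K →ₗᵢ[ℂ] H} {f : H} : f ∈ rangePerp W ↔ ∀ u, ⟪W u, f⟫_ℂ = 0 := by
  simp [Submodule.mem_orthogonal]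

lemma inner_apply_rangePerp (W : K →ₗᵢ[ℂ] H) (u : K) (n : rangePerp W) : ⟪W u, (n : H)⟫_ℂ = 0 :=
  mem_rangePerp_iff.1 n.2 u

lemma inner_add_rangePerp (W : K →ₗᵢ[ℂ] H) (u u' : K) (n n' : rangePerp W) :
    ⟪W u + n, W u' + n'⟫_ℂ = ⟪u, u'⟫_ℂ + ⟪n, n'⟫_ℂ := by
  simp [inner_apply_rangePerp, inner_eq_zero_symm.1]

lemma norm_sq_add_rangePerp (W : K →ₗᵢ[ℂ] H) (u : K) (n : rangePerp W) :
    ‖W u + n‖ ^ 2 = ‖u‖ ^ 2 + ‖n‖ ^ 2 := by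
  have h := inner_add_rangePerp W u u n n
  simp only [inner_self_eq_norm_sq_to_K] at h
  exact_mod_cast h

lemma add_rangePerp_inj (W : K →ₗᵢ[ℂ] H) {u u' : K} {n n' : rangePerp W} :
    W u + n = W u' + n' ↔ u = u' ∧ n = n' := by
  refine ⟨fun h => ?_, by rintro ⟨rfl, rfl⟩; rfl⟩
  have hz : W (u - u') + (n - n' : rangePerp W) = 0 := by
    rw [map_sub, AddSubgroupClass.coe_sub, ← sub_eq_zero.2 h]; abel
  have hsq := norm_sq_add_rangePerp W (u - u') (n - n')
  rw [hz, norm_zero] at hsq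
  constructor <;> rw [← sub_eq_zero, ← norm_eq_zero, ← sq_eq_zero_iff] <;> nlinarith [
    sq_nonneg ‖u - u'‖, sq_nonneg ‖n - n'‖]

section OrthogonalSum

variable [CompleteSpace H] [CompleteSpace K]

instance (W : K →ₗᵢ[ℂ] H) : CompleteSpace (LinearMap.range W.toLinearMap) :=
  W.isometry.isClosedEmbedding.isClosed_range.completeSpace_coe

lemma exists_add_rangePerp (W : K →ₗᵢ[ℂ] H) (f : H) :
    ∃ (u : K) (n : rangePerp W), W u + n = f := by
  obtain ⟨u, hu⟩ := (LinearMap.range W.toLinearMap).starProjection_apply_mem f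
  exact ⟨u, ⟨_, Submodule.sub_starProjection_mem_orthogonal f⟩, by
    change W u = _ at hu; simp [hu]⟩

/-- The operator `S ⊕ T` with respect to the decomposition `H = W K ⊕ (W K)ᗮ`. -/
def orthogonalSum (W : K →ₗᵢ[ℂ] H) (S : K →L[ℂ] K) (T : rangePerp W →L[ℂ] rangePerp W) :
    H →L[ℂ] H :=
  W.toContinuousLinearMap ∘L S ∘L adjoint W.toContinuousLinearMap +
    (rangePerp W).subtypeL ∘L T ∘L (rangePerp W).orthogonalProjectionOnto

lemma orthogonalSum_add (W : K →ₗᵢ[ℂ] H) (S : K →L[ℂ] K) (T : rangePerp W →L[ℂ] rangePerp W)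
    (u : K) (n : rangePerp W) : orthogonalSum W S T (W u + n) = W (S u) + T n := by
  have hadj : adjoint W.toContinuousLinearMap (W u + n) = u := by
    refine ext_inner_left ℂ fun v => ?_
    rw [adjoint_inner_right, W.coe_toContinuousLinearMap, inner_add_right, inner_apply_rangePerp,
      add_zero, W.inner_map_map]
  have hproj : (rangePerp W).orthogonalProjectionOnto (W u + n) = n := by
    rw [map_add, Submodule.orthogonalProjectionOnto_mem_subspace_eq_self,
      Submodule.orthogonalProjectionOnto_apply_of_mem_orthogonal, zero_add]
    exact Submodule.le_orthogonal_orthogonal _ ⟨u, rfl⟩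
  simp only [orthogonalSum, add_apply, comp_apply, hadj, hproj]
  rfl

lemma ext_add_rangePerp (W : K →ₗᵢ[ℂ] H) {S T : H →L[ℂ] H}
    (h : ∀ (u : K) (n : rangePerp W), S (W u + n) = T (W u + n)) : S = T := by
  refine ContinuousLinearMap.ext fun f => ?_
  obtain ⟨u, n, rfl⟩ := exists_add_rangePerp W f
  exact h u n

lemma isStarProjection_orthogonalSum (W : K →ₗᵢ[ℂ] H) {S : K →L[ℂ] K}
    {T : rangePerp W →L[ℂ] rangePerp W} (hS : IsStarProjection S) (hT : IsStarProjection T) :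
    IsStarProjection (orthogonalSum W S T) where
  isIdempotentElem := ext_add_rangePerp W fun u n => by
    rw [mul_def, comp_apply, orthogonalSum_add, orthogonalSum_add, ← comp_apply S, ← comp_apply T,
      ← mul_def, ← mul_def, hS.isIdempotentElem.eq, hT.isIdempotentElem.eq]
  isSelfAdjoint := by
    have hS' := isSelfAdjoint_iff_isSymmetric.1 hS.isSelfAdjoint
    have hT' := isSelfAdjoint_iff_isSymmetric.1 hT.isSelfAdjoint
    rw [isSelfAdjoint_iff_isSymmetric]
    intro f g
    obtain ⟨u, n, rfl⟩ := exists_add_rangePerp W f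
    obtain ⟨v, k, rfl⟩ := exists_add_rangePerp W g
    simp only [coe_coe, orthogonalSum_add, inner_add_rangePerp]
    exact congrArg₂ _ (hS' u v) (hT' n k)

/-- The spectral resolution `E ⊕ F` with respect to the decomposition `H = W K ⊕ (W K)ᗮ`. -/
def sumPVM (W : K →ₗᵢ[ℂ] H) (E : ProjectionValuedMeasure K)
    (F : ProjectionValuedMeasure (rangePerp W)) : ProjectionValuedMeasure H where
  proj B := orthogonalSum W (E.proj B) (F.proj B)
  isStarProjection B hB :=
    isStarProjection_orthogonalSum W (E.isStarProjection B hB) (F.isStarProjection B hB)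
  proj_empty := by simp [orthogonalSum, E.proj_empty, F.proj_empty]
  proj_univ := ext_add_rangePerp W fun u n => by
    rw [orthogonalSum_add, E.proj_univ, F.proj_univ]; rfl
  proj_inter B C hB hC := ext_add_rangePerp W fun u n => by
    rw [mul_def, comp_apply, orthogonalSum_add, orthogonalSum_add, orthogonalSum_add,
      E.proj_inter B C hB hC, F.proj_inter B C hB hC]; rfl
  proj_iUnion B hB hd f := by
    obtain ⟨u, n, rfl⟩ := exists_add_rangePerp W f
    simp only [orthogonalSum_add]
    exact ((E.proj_iUnion B hB hd u).mapL W.toContinuousLinearMap).add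
      ((F.proj_iUnion B hB hd n).mapL (rangePerp W).subtypeL)

variable (W : K →ₗᵢ[ℂ] H) (E : ProjectionValuedMeasure K)
  (F : ProjectionValuedMeasure (rangePerp W))

lemma scalarMeasure_sumPVM (u : K) (n : rangePerp W) :
    (sumPVM W E F).scalarMeasure (W u + n) = E.scalarMeasure u + F.scalarMeasure n := by
  refine Measure.ext fun B hB => ?_
  rw [Measure.add_apply, ProjectionValuedMeasure.scalarMeasure_apply _ _ hB,
    ProjectionValuedMeasure.scalarMeasure_apply _ _ hB,
    ProjectionValuedMeasure.scalarMeasure_apply _ _ hB,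
    ← ENNReal.ofReal_add (by positivity) (by positivity), ← norm_sq_add_rangePerp,
    ← orthogonalSum_add]
  rfl

lemma add_mem_acSubspace_sumPVM_iff {u : K} {n : rangePerp W} :
    W u + n ∈ (sumPVM W E F).acSubspace ↔ u ∈ E.acSubspace ∧ n ∈ F.acSubspace := by
  change _ ≪ _ ↔ _ ≪ _ ∧ _ ≪ _
  rw [scalarMeasure_sumPVM, Measure.AbsolutelyContinuous.add_left_iff]

lemma acSubspace_sumPVM (hE : E.acSubspace = ⊤) (hF : F.acSubspace = ⊥) :
    (sumPVM W E F).acSubspace = LinearMap.range W.toLinearMap := by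
  ext f
  obtain ⟨u, n, rfl⟩ := exists_add_rangePerp W f
  rw [add_mem_acSubspace_sumPVM_iff, hE, hF, Submodule.mem_bot]
  constructor
  · rintro ⟨-, rfl⟩
    exact ⟨u, by simp⟩
  · rintro ⟨v, hv⟩
    have hv' : W u + n = W v + (0 : rangePerp W) := by rw [← hv]; simp
    exact ⟨Submodule.mem_top, ((add_rangePerp_inj W).1 hv').2⟩

end OrthogonalSum

lemma mem_boundStates_of_mem_graph {A : H →ₗ.[ℂ] H} {f : H} {t : ℝ}
    (h : (f, (t : ℂ) • f) ∈ A.graph) : f ∈ boundStates A := by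
  obtain ⟨u, rfl, hu⟩ := A.mem_graph_iff.1 h
  exact Submodule.le_topologicalClosure _ (Submodule.subset_span ⟨u.2, t, hu⟩)

/-! ### Intertwining isometries -/

/-- The isometry `W` intertwines `A₀` with `A`: `A W = W A₀`, including equality of domains. -/
structure Intertwines (W : K →ₗᵢ[ℂ] H) (A₀ : K →ₗ.[ℂ] K) (A : H →ₗ.[ℂ] H) : Prop where
  map_graph : ∀ {u g}, (u, g) ∈ A₀.graph → (W u, W g) ∈ A.graph
  mem_domain : ∀ {u}, W u ∈ A.domain → u ∈ A₀.domain

namespace Intertwines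

variable {W : K →ₗᵢ[ℂ] H} {A₀ : K →ₗ.[ℂ] K} {A : H →ₗ.[ℂ] H}

lemma mem_graph_iff (h : Intertwines W A₀ A) {u : K} {f : H} :
    (W u, f) ∈ A.graph ↔ ∃ g, (u, g) ∈ A₀.graph ∧ f = W g := by
  constructor
  · intro hf
    have hu := A₀.mem_graph ⟨u, h.mem_domain (A.mem_domain_of_mem_graph hf)⟩
    exact ⟨_, hu, A.mem_graph_snd_inj hf (h.map_graph hu) rfl⟩
  · rintro ⟨g, hg, rfl⟩
    exact h.map_graph hg

lemma mem_graph_map_iff (h : Intertwines W A₀ A) {u g : K} :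
    (W u, W g) ∈ A.graph ↔ (u, g) ∈ A₀.graph := by
  simp [h.mem_graph_iff, W.injective.eq_iff]

lemma comp_isometryEquiv {L : Type*} [NormedAddCommGroup L] [InnerProductSpace ℂ L]
    (h : Intertwines W A₀ A) {e : L ≃ₗᵢ[ℂ] K} {A₁ : L →ₗ.[ℂ] L}
    (he : Intertwines e.toLinearIsometry A₁ A₀) :
    Intertwines (W.comp e.toLinearIsometry) A₁ A where
  map_graph hu := h.map_graph (he.map_graph hu)
  mem_domain hu := he.mem_domain (h.mem_domain hu)

lemma mem_rangePerp (h : Intertwines W A₀ A) (hA : A.IsFormalAdjoint A)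
    (hdense : Dense (A₀.domain : Set K)) {n g : H} (hn : n ∈ rangePerp W)
    (hng : (n, g) ∈ A.graph) : g ∈ rangePerp W := by
  have hclosed : IsClosed {u : K | ⟪W u, g⟫_ℂ = 0} :=
    isClosed_eq (W.continuous.inner continuous_const) continuous_const
  have hsubset : (A₀.domain : Set K) ⊆ {u : K | ⟪W u, g⟫_ℂ = 0} := fun u hu =>
    (isFormalAdjoint_self_iff.1 hA _ _ _ _ (h.map_graph (A₀.mem_graph ⟨u, hu⟩)) hng).symm.trans
      (mem_rangePerp_iff.1 hn _)
  exact mem_rangePerp_iff.2 fun u => hclosed.closure_subset_iff.2 hsubset (hdense u)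

lemma domain_part_rangePerp (h : Intertwines W A₀ A) (hA : A.IsFormalAdjoint A)
    (hdense : Dense (A₀.domain : Set K)) (hle : rangePerp W ≤ A.domain) :
    (part A (rangePerp W)).domain = ⊤ :=
  eq_top_iff.2 fun n _ =>
    ⟨hle n.2, h.mem_rangePerp hA hdense n.2 (A.mem_graph ⟨n, hle n.2⟩)⟩

lemma mem_graph_add_iff (h : Intertwines W A₀ A) (hT : (part A (rangePerp W)).domain = ⊤)
    {u : K} {n : rangePerp W} {f : H} :
    (W u + n, f) ∈ A.graph ↔
      ∃ g k, (u, g) ∈ A₀.graph ∧ (n, k) ∈ (part A (rangePerp W)).graph ∧ f = W g + k := by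
  have hn := (part A (rangePerp W)).mem_graph ⟨n, hT ▸ Submodule.mem_top⟩
  have hn' := mem_graph_part.1 hn
  constructor
  · intro hf
    have hsub := A.graph.sub_mem hf hn'
    rw [Prod.mk_sub_mk, add_sub_cancel_right] at hsub
    obtain ⟨g, hg, hfg⟩ := h.mem_graph_iff.1 hsub
    exact ⟨g, _, hg, hn, sub_eq_iff_eq_add.1 hfg⟩
  · rintro ⟨g, k, hg, hk, rfl⟩
    exact A.graph.add_mem (h.map_graph hg) (mem_graph_part.1 hk)

lemma add_mem_domain_iff (h : Intertwines W A₀ A) (hT : (part A (rangePerp W)).domain = ⊤)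
    {u : K} {n : rangePerp W} : W u + n ∈ A.domain ↔ u ∈ A₀.domain := by
  have hn : (n : H) ∈ A.domain :=
    A.mem_domain_of_mem_graph (mem_graph_part.1
      ((part A (rangePerp W)).mem_graph ⟨n, hT ▸ Submodule.mem_top⟩))
  rw [A.domain.add_mem_iff_left hn]
  exact ⟨h.mem_domain, fun hu => A.mem_domain_of_mem_graph (h.map_graph (A₀.mem_graph ⟨u, hu⟩))⟩

lemma operatorSpectrum_part_range (h : Intertwines W A₀ A) :
    operatorSpectrum (part A (LinearMap.range W.toLinearMap)) = operatorSpectrum A₀ :=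
  operatorSpectrum_eq_of_mem_graph_iff W.equivRange fun u g =>
    h.mem_graph_map_iff.symm.trans
      (mem_graph_part (f := W.equivRange u) (g := W.equivRange g)).symm

variable [CompleteSpace H] [CompleteSpace K]

lemma represents_sumPVM (h : Intertwines W A₀ A) (hT : (part A (rangePerp W)).domain = ⊤)
    {E : ProjectionValuedMeasure K} (hE : E.Represents A₀)
    {F : ProjectionValuedMeasure (rangePerp W)} (hF : F.Represents (part A (rangePerp W))) :
    (sumPVM W E F).Represents A := by
  have hfin : ∀ n, ∫⁻ t, ENNReal.ofReal (t ^ 2) ∂(F.scalarMeasure n) < ∞ := fun n =>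
    (hF.1 n).1 (hT ▸ Submodule.mem_top)
  constructor
  · intro f
    obtain ⟨u, n, rfl⟩ := exists_add_rangePerp W f
    rw [h.add_mem_domain_iff hT, hE.1, scalarMeasure_sumPVM, lintegral_add_measure,
      ENNReal.add_lt_top, and_iff_left (hfin n)]
  · rintro ⟨f, hf⟩
    obtain ⟨u, n, rfl⟩ := exists_add_rangePerp W f
    obtain ⟨g, k, hg, hk, hfgk⟩ := (h.mem_graph_add_iff hT).1 (A.mem_graph ⟨_, hf⟩)
    obtain ⟨u, rfl, rfl⟩ := A₀.mem_graph_iff.1 hg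
    obtain ⟨n, rfl, rfl⟩ := (part A (rangePerp W)).mem_graph_iff.1 hk
    rw [hfgk, inner_add_rangePerp, hE.2, hF.2, scalarMeasure_sumPVM,
      integral_add_measure (E.integrable_id_scalarMeasure ((hE.1 u).1 u.2))
        (F.integrable_id_scalarMeasure (hfin n)), Complex.ofReal_add]

lemma boundStates_eq [FiniteDimensional ℂ (rangePerp W)] (h : Intertwines W A₀ A)
    (hA : A.IsFormalAdjoint A) (hT : (part A (rangePerp W)).domain = ⊤)
    (hA₀ : ∀ (u : K) (t : ℝ), (u, (t : ℂ) • u) ∈ A₀.graph → u = 0) :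
    boundStates A = rangePerp W := by
  refine le_antisymm (Submodule.topologicalClosure_minimal _ (Submodule.span_le.2 ?_)
    (Submodule.isClosed_orthogonal _)) fun f hf => ?_
  · rintro f ⟨hf, t, hft⟩
    obtain ⟨u, n, rfl⟩ := exists_add_rangePerp W f
    obtain ⟨g, k, hg, -, hgk⟩ := (h.mem_graph_add_iff hT).1 (A.mem_graph ⟨_, hf⟩)
    have hsmul : W ((t : ℂ) • u) + (((t : ℂ) • n : rangePerp W) : H) = W g + k := by
      rw [← hgk, hft, smul_add, map_smul]; rfl
    have hu : u = 0 := hA₀ u t (((add_rangePerp_inj W).1 hsmul).1 ▸ hg)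
    simp [hu]
  · obtain ⟨b, μ, hb⟩ := exists_orthonormalBasis_eigenvectors (isFormalAdjoint_part hA _) hT
    have hsum := congrArg (rangePerp W).subtype (b.sum_repr ⟨f, hf⟩)
    rw [map_sum] at hsum
    change _ = f at hsum
    exact hsum ▸ Submodule.sum_mem _ fun i _ =>
      Submodule.smul_mem _ _ (mem_boundStates_of_mem_graph (mem_graph_part.1 (hb i)))

theorem hasPurelyACSpectrumOffBoundStates [FiniteDimensional ℂ (rangePerp W)]
    (h : Intertwines W A₀ A) (hA : A.IsFormalAdjoint A) (hT : (part A (rangePerp W)).domain = ⊤)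
    (hA₀ : ∀ (u : K) (t : ℝ), (u, (t : ℂ) • u) ∈ A₀.graph → u = 0)
    {E : ProjectionValuedMeasure K} (hE : E.Represents A₀) (hac : E.acSubspace = ⊤) {S : Set ℝ}
    (hS : operatorSpectrum A₀ = Complex.ofReal '' S) : HasPurelyACSpectrumOffBoundStates A S := by
  have hperp : (boundStates A)ᗮ = LinearMap.range W.toLinearMap := by
    rw [h.boundStates_eq hA hT hA₀, Submodule.orthogonal_orthogonal]
  obtain ⟨b, μ, hb⟩ := exists_orthonormalBasis_eigenvectors (isFormalAdjoint_part hA _) hT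
  refine ⟨sumPVM W E (diagPVM b μ),
    h.represents_sumPVM hT hE (diagPVM_represents hb hT), ?_, ?_⟩
  · rw [acSubspace_sumPVM W E _ hac (acSubspace_diagPVM ..), hperp]
  · rw [hperp, h.operatorSpectrum_part_range, hS]

end Intertwines

end OperatorTheory

/-! ### Multiplication operators -/

lemma inner_L2 (f g : L2) : ⟪f, g⟫_ℂ = ∫ x, (starRingEnd ℂ) (f x) * g x := by
  simp only [L2.inner_def, RCLike.inner_apply']

lemma integrable_norm_sq (f : L2) : Integrable (fun x => ‖f x‖ ^ 2) :=
  (memLp_two_iff_integrable_sq_norm (Lp.aestronglyMeasurable f)).1 (Lp.memLp f)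

lemma norm_sq_eq_integral (f : L2) : ‖f‖ ^ 2 = ∫ x, ‖f x‖ ^ 2 := by
  have h := inner_self_eq_norm_sq_to_K (𝕜 := ℂ) f
  simp only [inner_L2, RCLike.conj_mul] at h
  norm_cast at h
  exact h.symm

lemma mem_graph_mulOp {q : ℝ → ℂ} {f g : L2} :
    (f, g) ∈ (mulOp q).graph ↔ g =ᵐ[volume] fun x => q x * f x := by
  constructor
  · intro h
    obtain ⟨f, rfl, rfl⟩ := (mulOp q).mem_graph_iff.1 h
    exact MemLp.coeFn_toLp f.2
  · intro h
    have hf : f ∈ (mulOp q).domain := (memLp_congr_ae h).1 (Lp.memLp g)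
    exact (mulOp q).mem_graph_iff.2
      ⟨⟨f, hf⟩, rfl, Lp.ext ((MemLp.coeFn_toLp hf).trans h.symm)⟩

lemma isFormalAdjoint_mulOp (q : ℝ → ℝ) :
    (mulOp fun x => (q x : ℂ)).IsFormalAdjoint (mulOp fun x => (q x : ℂ)) := by
  refine isFormalAdjoint_self_iff.2 fun f f' g g' hf hg => ?_
  rw [inner_L2, inner_L2]
  refine integral_congr_ae ?_
  filter_upwards [mem_graph_mulOp.1 hf, mem_graph_mulOp.1 hg] with x hf hg
  rw [hf, hg, map_mul, Complex.conj_ofReal]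
  ring

section MulBdd

variable {q r s : ℝ → ℂ} {hq : Measurable q} {hr : Measurable r} {hs : Measurable s}
  {C D B : ℝ} {hC : ∀ x, ‖q x‖ ≤ C} {hD : ∀ x, ‖r x‖ ≤ D} {hB : ∀ x, ‖s x‖ ≤ B}

lemma coeFn_mulBdd (f : L2) : mulBdd q hq C hC f =ᵐ[volume] fun x => q x * f x :=
  mem_graph_mulOp.1 ((mulOp q).mem_graph ⟨f, (Lp.memLp f).of_le_mul
    (hq.aestronglyMeasurable.mul (Lp.aestronglyMeasurable f)) (.of_forall fun x => by
      rw [norm_mul]; exact mul_le_mul_of_nonneg_right (hC x) (norm_nonneg _))⟩)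

lemma mulBdd_mulBdd (h : ∀ x, q x * r x = s x) (f : L2) :
    mulBdd q hq C hC (mulBdd r hr D hD f) = mulBdd s hs B hB f := by
  refine Lp.ext ?_
  filter_upwards [coeFn_mulBdd (hq := hq) (hC := hC) (mulBdd r hr D hD f),
    coeFn_mulBdd (hq := hr) (hC := hD) f, coeFn_mulBdd (hq := hs) (hC := hB) f] with x h₁ h₂ h₃
  rw [h₁, h₂, h₃, ← h, mul_assoc]

lemma mulBdd_eq_self (h : ∀ x, q x = 1) (f : L2) : mulBdd q hq C hC f = f := by
  refine Lp.ext ?_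
  filter_upwards [coeFn_mulBdd (hq := hq) (hC := hC) f] with x hx
  rw [hx, h, one_mul]

lemma mulBdd_mulBdd_eq_self (h : ∀ x, q x * r x = 1) (f : L2) :
    mulBdd q hq C hC (mulBdd r hr D hD f) = f :=
  (mulBdd_mulBdd (hs := measurable_const) (B := 1) (hB := by simp) h f).trans
    (mulBdd_eq_self (fun _ => rfl) f)

lemma inner_mulBdd_left (h : ∀ x, r x = (starRingEnd ℂ) (q x)) (f g : L2) :
    ⟪mulBdd q hq C hC f, g⟫_ℂ = ⟪f, mulBdd r hr D hD g⟫_ℂ := by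
  rw [inner_L2, inner_L2]
  refine integral_congr_ae ?_
  filter_upwards [coeFn_mulBdd (hq := hq) (hC := hC) f,
    coeFn_mulBdd (hq := hr) (hC := hD) g] with x hf hg
  rw [hf, hg, h, map_mul]
  ring

lemma eq_zero_of_mulBdd_eq_zero (h : ∀ x, q x ≠ 0) {f : L2} (hf : mulBdd q hq C hC f = 0) :
    f = 0 := by
  refine (Lp.eq_zero_iff_ae_eq_zero).2 ?_
  filter_upwards [coeFn_mulBdd (hq := hq) (hC := hC) f,
    (Lp.eq_zero_iff_ae_eq_zero).1 hf] with x h₁ h₂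
  exact (mul_eq_zero.1 (h₁.symm.trans h₂)).resolve_left (h x)

end MulBdd

lemma dense_domain_mulOp {q : ℝ → ℂ} (hq : Measurable q) :
    Dense ((mulOp q).domain : Set L2) := by
  let w : ℝ → ℂ := fun x => ((1 + ‖q x‖)⁻¹ : ℝ)
  have hw : Measurable w := (hq.norm.const_add 1).inv.complex_ofReal
  have hnorm : ∀ x, ‖w x‖ = (1 + ‖q x‖)⁻¹ := fun x =>
    (Complex.norm_real _).trans (Real.norm_of_nonneg (by positivity))
  have hw₁ : ∀ x, ‖w x‖ ≤ 1 := fun x =>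
    (hnorm x).trans_le (inv_le_one_of_one_le₀ (by linarith [norm_nonneg (q x)]))
  have hqw : ∀ x, ‖q x * w x‖ ≤ 1 := fun x => by
    rw [norm_mul, hnorm, ← div_eq_mul_inv, div_le_one (by positivity)]
    linarith
  have hdom : ∀ f, mulBdd w hw 1 hw₁ f ∈ (mulOp q).domain := fun f => by
    refine (mulOp q).mem_domain_of_mem_graph (y := mulBdd (q * w) (hq.mul hw) 1 hqw f) ?_
    refine mem_graph_mulOp.2 ?_
    filter_upwards [coeFn_mulBdd (hq := hw) (hC := hw₁) f,
      coeFn_mulBdd (hq := hq.mul hw) (hC := hqw) f] with x h₁ h₂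
    rw [h₁, h₂, Pi.mul_apply, mul_assoc]
  rw [Submodule.dense_iff_topologicalClosure_eq_top, Submodule.topologicalClosure_eq_top_iff,
    Submodule.eq_bot_iff]
  intro f hf
  have hwf : mulBdd w hw 1 hw₁ f = 0 := ext_inner_left ℂ fun g => by
    rw [inner_zero_right, ← inner_mulBdd_left (hq := hw) (hC := hw₁)
      fun x => (Complex.conj_ofReal _).symm]
    exact hf _ (hdom g)
  refine eq_zero_of_mulBdd_eq_zero (fun x hx => ?_) hwf
  have hpos : 0 < (1 + ‖q x‖)⁻¹ := by positivity
  rw [← hnorm, hx, norm_zero] at hpos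
  exact hpos.false

lemma notMem_operatorSpectrum_mulOp {q : ℝ → ℂ} (hq : Measurable q) {z : ℂ} {δ : ℝ} (hδ : 0 < δ)
    (h : ∀ x, δ ≤ ‖q x - z‖) : z ∉ operatorSpectrum (mulOp q) := by
  have hne : ∀ x, q x - z ≠ 0 := fun x => norm_pos_iff.1 (hδ.trans_le (h x))
  have hmeas : Measurable fun x => (q x - z)⁻¹ := (hq.sub_const z).inv
  have hbound : ∀ x, ‖(q x - z)⁻¹‖ ≤ δ⁻¹ := fun x => by
    rw [norm_inv]; exact inv_anti₀ hδ (h x)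
  let T := mulBdd _ hmeas _ hbound
  have hT : ∀ f, T f =ᵐ[volume] fun x => (q x - z)⁻¹ * f x := fun f => coeFn_mulBdd f
  refine notMem_operatorSpectrum_iff.2 ⟨T, fun f => mem_graph_mulOp.2 ?_, fun u g hu => Lp.ext ?_⟩
  · filter_upwards [hT f, Lp.coeFn_add f (z • T f), Lp.coeFn_smul z (T f)] with x h₁ h₂ h₃
    have := hne x
    rw [h₂, Pi.add_apply, h₃, Pi.smul_apply, h₁, smul_eq_mul]
    field_simp
    ring
  · filter_upwards [hT (g - z • u), Lp.coeFn_sub g (z • u), Lp.coeFn_smul z u,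
      mem_graph_mulOp.1 hu] with x h₁ h₂ h₃ h₄
    rw [h₁, h₂, Pi.sub_apply, h₃, Pi.smul_apply, h₄, smul_eq_mul, ← sub_mul,
      inv_mul_cancel_left₀ (hne x)]

lemma exists_mem_graph_mulOp_norm_sub_le {q : ℝ → ℂ} (hq : Measurable q) {z : ℂ} {ε : ℝ}
    (h : volume {x | ‖q x - z‖ ≤ ε} ≠ 0) :
    ∃ f g, (f, g) ∈ (mulOp q).graph ∧ f ≠ 0 ∧ ‖g - z • f‖ ≤ ε * ‖f‖ := by
  have hmeas : MeasurableSet {x | ‖q x - z‖ ≤ ε} :=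
    measurableSet_le (hq.sub_const z).norm measurable_const
  obtain ⟨I, hI, hIsub, hIpos, hIfin⟩ :=
    Measure.exists_subset_measure_lt_top hmeas (pos_iff_ne_zero.2 h)
  let f : L2 := indicatorConstLp 2 hI hIfin.ne (1 : ℂ)
  have hf : f =ᵐ[volume] I.indicator fun _ => 1 := indicatorConstLp_coeFn
  have hqf : MemLp (fun x => q x * f x) 2 volume := by
    refine (Lp.memLp f).of_le_mul (c := ε + ‖z‖)
      (hq.aestronglyMeasurable.mul (Lp.aestronglyMeasurable f)) ?_
    filter_upwards [hf] with x hx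
    by_cases hxI : x ∈ I
    · rw [norm_mul]
      have := norm_le_norm_sub_add (q x) z
      gcongr
      linarith [show ‖q x - z‖ ≤ ε from hIsub hxI]
    · simp [hx, hxI]
  refine ⟨f, hqf.toLp, mem_graph_mulOp.2 hqf.coeFn_toLp, ?_, ?_⟩
  · rw [← norm_ne_zero_iff, norm_indicatorConstLp two_ne_zero ENNReal.ofNat_ne_top, norm_one,
      one_mul]
    exact (Real.rpow_pos_of_pos (ENNReal.toReal_pos hIpos.ne' hIfin.ne) _).ne'
  · refine Lp.norm_le_mul_norm_of_ae_le_mul ?_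
    filter_upwards [Lp.coeFn_sub hqf.toLp (z • f), Lp.coeFn_smul z f, hqf.coeFn_toLp, hf]
      with x h₁ h₂ h₃ h₄
    rw [h₁, Pi.sub_apply, h₂, Pi.smul_apply, h₃, smul_eq_mul, ← sub_mul, norm_mul]
    by_cases hxI : x ∈ I
    · gcongr
      exact hIsub hxI
    · simp [h₄, hxI]

lemma mem_operatorSpectrum_mulOp {q : ℝ → ℂ} (hq : Measurable q) {z : ℂ}
    (h : ∀ ε > 0, volume {x | ‖q x - z‖ ≤ ε} ≠ 0) : z ∈ operatorSpectrum (mulOp q) := by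
  by_contra hz
  obtain ⟨T, -, hT⟩ := notMem_operatorSpectrum_iff.1 hz
  have hε : 0 < (2 * (‖T‖ + 1))⁻¹ := by positivity
  obtain ⟨f, g, hfg, hf, hle⟩ := exists_mem_graph_mulOp_norm_sub_le hq (h _ hε)
  have hf' : 0 < ‖f‖ := norm_pos_iff.2 hf
  refine lt_irrefl ‖f‖ ?_
  calc ‖f‖ = ‖T (g - z • f)‖ := by rw [hT f g hfg]
    _ ≤ ‖T‖ * ‖g - z • f‖ := T.le_opNorm _
    _ ≤ (‖T‖ + 1) * ((2 * (‖T‖ + 1))⁻¹ * ‖f‖) := by gcongr; linarith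
    _ = ‖f‖ / 2 := by field_simp
    _ < ‖f‖ := half_lt_self hf'

lemma eq_zero_of_mem_graph_mulOp_smul {q : ℝ → ℂ} {z : ℂ} (hz : volume {x | q x = z} = 0)
    {f : L2} (hf : (f, z • f) ∈ (mulOp q).graph) : f = 0 := by
  refine Lp.eq_zero_iff_ae_eq_zero.2 ?_
  filter_upwards [mem_graph_mulOp.1 hf, Lp.coeFn_smul z f, measure_eq_zero_iff_ae_notMem.1 hz]
    with x h₁ h₂ h₃
  rw [h₂, Pi.smul_apply, smul_eq_mul, eq_comm, mul_eq_mul_right_iff] at h₁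
  exact h₁.resolve_left h₃

/-! ### Spectral resolution of a multiplication operator -/

/-- Multiplication by the indicator function of `s`. -/
def indicatorL2 {s : Set ℝ} (hs : MeasurableSet s) : L2 →L[ℂ] L2 :=
  mulBdd (s.indicator 1) (measurable_one.indicator hs) 1
    (fun x => (norm_indicator_le_norm_self _ x).trans (by simp))

lemma coeFn_indicatorL2 {s : Set ℝ} (hs : MeasurableSet s) (f : L2) :
    indicatorL2 hs f =ᵐ[volume] s.indicator f := by
  refine (coeFn_mulBdd f).trans (.of_forall fun x => ?_)
  by_cases hx : x ∈ s <;> simp [hx]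

lemma indicatorL2_inter {s t : Set ℝ} (hs : MeasurableSet s) (ht : MeasurableSet t) :
    indicatorL2 (hs.inter ht) = indicatorL2 hs * indicatorL2 ht := by
  refine ContinuousLinearMap.ext fun f => Eq.symm ?_
  change indicatorL2 hs (indicatorL2 ht f) = _
  refine mulBdd_mulBdd (fun x => ?_) f
  by_cases hxs : x ∈ s <;> by_cases hxt : x ∈ t <;> simp [hxs, hxt]

lemma isStarProjection_indicatorL2 {s : Set ℝ} (hs : MeasurableSet s) :
    IsStarProjection (indicatorL2 hs) where
  isIdempotentElem := by
    rw [IsIdempotentElem, ← indicatorL2_inter]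
    simp only [Set.inter_self]
  isSelfAdjoint := isSelfAdjoint_iff_isSymmetric.2 fun f g => inner_mulBdd_left (fun x => by
    by_cases hx : x ∈ s <;> simp [hx]) f g

lemma indicatorL2_empty : indicatorL2 MeasurableSet.empty = 0 :=
  ContinuousLinearMap.ext fun f => Lp.eq_zero_iff_ae_eq_zero.2
    ((coeFn_indicatorL2 _ f).trans (by rw [Set.indicator_empty']))

lemma norm_sq_indicatorL2 {s : Set ℝ} (hs : MeasurableSet s) (f : L2) :
    ‖indicatorL2 hs f‖ ^ 2 = ∫ x in s, ‖f x‖ ^ 2 := by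
  rw [norm_sq_eq_integral, ← integral_indicator hs]
  refine integral_congr_ae ?_
  filter_upwards [coeFn_indicatorL2 hs f] with x hx
  by_cases hxs : x ∈ s <;> simp [hx, hxs]

lemma hasSum_of_pairwise_orthogonal {H ι : Type*} [NormedAddCommGroup H] [InnerProductSpace ℂ H]
    {u : ι → H} {v : H} (huv : ∀ n, ⟪u n, v⟫_ℂ = ⟪u n, u n⟫_ℂ)
    (hu : Pairwise fun i j => ⟪u i, u j⟫_ℂ = 0)
    (hsum : HasSum (fun n => ‖u n‖ ^ 2) (‖v‖ ^ 2)) : HasSum u v := by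
  have hnorm : ∀ s : Finset ι, ‖v - ∑ n ∈ s, u n‖ ^ 2 = ‖v‖ ^ 2 - ∑ n ∈ s, ‖u n‖ ^ 2 := fun s => by
    have hss : ⟪∑ n ∈ s, u n, ∑ n ∈ s, u n⟫_ℂ = ∑ n ∈ s, ⟪u n, u n⟫_ℂ := by
      simp only [sum_inner, inner_sum]
      exact Finset.sum_congr rfl fun i hi =>
        Finset.sum_eq_single_of_mem i hi fun j _ hj => hu hj
    have hsv : ⟪∑ n ∈ s, u n, v⟫_ℂ = ∑ n ∈ s, ⟪u n, u n⟫_ℂ := by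
      simp only [sum_inner, huv]
    have hre : RCLike.re (∑ n ∈ s, ⟪u n, u n⟫_ℂ) = ∑ n ∈ s, ‖u n‖ ^ 2 := by
      simp only [map_sum, inner_self_eq_norm_sq]
    rw [@norm_sub_sq ℂ, ← inner_re_symm, hsv, ← inner_self_eq_norm_sq (𝕜 := ℂ) (∑ n ∈ s, u n), hss,
      hre]
    ring
  have hlim :
      Filter.Tendsto (fun s : Finset ι => ‖v - ∑ n ∈ s, u n‖ ^ 2) Filter.atTop (nhds 0) := by
    simp only [hnorm]
    rw [← sub_self (‖v‖ ^ 2)]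
    exact Filter.Tendsto.const_sub _ hsum
  rw [HasSum, tendsto_iff_norm_sub_tendsto_zero]
  simpa [norm_sub_rev] using hlim.sqrt

lemma hasSum_indicatorL2 {B : ℕ → Set ℝ} (hB : ∀ n, MeasurableSet (B n))
    (hd : Pairwise (Function.onFun Disjoint B)) (f : L2) :
    HasSum (fun n => indicatorL2 (hB n) f) (indicatorL2 (MeasurableSet.iUnion hB) f) := by
  have hinner : ∀ n {t : Set ℝ} (ht : MeasurableSet t),
      ⟪indicatorL2 (hB n) f, indicatorL2 ht f⟫_ℂ = ⟪f, indicatorL2 ((hB n).inter ht) f⟫_ℂ := by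
    intro n t ht
    rw [indicatorL2_inter (hB n) ht]
    exact isSelfAdjoint_iff_isSymmetric.1 (isStarProjection_indicatorL2 (hB n)).isSelfAdjoint _ _
  refine hasSum_of_pairwise_orthogonal (fun n => ?_) (fun i j hij => ?_) ?_
  · simp only [hinner n (hB n), hinner n (MeasurableSet.iUnion hB), Set.inter_self,
      Set.inter_eq_left.2 (Set.subset_iUnion B n)]
  · simp only [hinner, (hd hij).inter_eq, indicatorL2_empty, zero_apply, inner_zero_right]
  · simp only [norm_sq_indicatorL2]
    exact hasSum_integral_iUnion hB hd (integrable_norm_sq f).integrableOn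

section MulPVM

variable {q : ℝ → ℝ} (hq : Measurable q)

open Classical in
/-- The spectral resolution of multiplication by `q`: the projection of `B` is multiplication by
the indicator function of `q ⁻¹' B`. Non-measurable sets get the junk value `0`. -/
def mulPVM : ProjectionValuedMeasure L2 where
  proj B := if hB : MeasurableSet B then indicatorL2 (hq hB) else 0
  isStarProjection B hB := by rw [dif_pos hB]; exact isStarProjection_indicatorL2 _
  proj_empty := (dif_pos .empty).trans indicatorL2_empty
  proj_univ := (dif_pos .univ).trans
    (ContinuousLinearMap.ext fun f => mulBdd_eq_self (by simp) f)
  proj_inter B C hB hC := by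
    simp only [dif_pos, hB, hC, hB.inter hC]
    exact indicatorL2_inter (hq hB) (hq hC)
  proj_iUnion B hB hd f := by
    simp only [dif_pos, hB, MeasurableSet.iUnion hB, Set.preimage_iUnion]
    exact hasSum_indicatorL2 (fun n => hq (hB n)) (fun i j hij => (hd hij).preimage q) f

lemma scalarMeasure_mulPVM (f : L2) :
    (mulPVM hq).scalarMeasure f = (volume.withDensity fun x => ‖f x‖ₑ ^ 2).map q := by
  refine Measure.ext fun B hB => ?_
  have hproj : (mulPVM hq).proj B = indicatorL2 (hq hB) := dif_pos hB
  rw [ProjectionValuedMeasure.scalarMeasure_apply _ _ hB, hproj, Measure.map_apply hq hB,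
    withDensity_apply _ (hq hB), norm_sq_indicatorL2, ofReal_integral_eq_lintegral_ofReal
    (integrable_norm_sq f).integrableOn (.of_forall fun _ => by positivity)]
  simp only [ENNReal.ofReal_pow (norm_nonneg _), ofReal_norm]

lemma acSubspace_mulPVM (hqmp : Measure.QuasiMeasurePreserving q volume volume) :
    (mulPVM hq).acSubspace = ⊤ :=
  eq_top_iff.2 fun f _ => by
    change _ ≪ volume
    rw [scalarMeasure_mulPVM]
    exact ((withDensity_absolutelyContinuous _ _).map hq).trans hqmp.absolutelyContinuous

lemma mulPVM_represents : (mulPVM hq).Represents (mulOp fun x => (q x : ℂ)) := by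
  have hmeas : ∀ f : L2, Measurable fun x => ‖f x‖₊ ^ 2 := fun f =>
    (Lp.stronglyMeasurable f).measurable.nnnorm.pow_const 2
  have hdensity : ∀ f : L2, (mulPVM hq).scalarMeasure f =
      (volume.withDensity fun x => ((‖f x‖₊ ^ 2 : NNReal) : ℝ≥0∞)).map q := fun f =>
    scalarMeasure_mulPVM hq f
  constructor
  · intro f
    change MemLp (fun x => (q x : ℂ) * f x) 2 volume ↔ _
    have haesm : AEStronglyMeasurable (fun x => (q x : ℂ) * f x) volume :=
      hq.complex_ofReal.aestronglyMeasurable.mul (Lp.aestronglyMeasurable f)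
    have hsq : AEStronglyMeasurable (fun x => ‖(q x : ℂ) * f x‖ ^ 2) volume := haesm.norm.pow 2
    rw [hdensity, lintegral_map (by fun_prop) hq, lintegral_withDensity_eq_lintegral_mul _
      (hmeas f).coe_nnreal_ennreal (hq.pow_const 2).ennreal_ofReal,
      memLp_two_iff_integrable_sq_norm haesm, Integrable,
      and_iff_right hsq, hasFiniteIntegral_iff_enorm]
    refine iff_of_eq (congrArg (· < ∞) (lintegral_congr fun x => ?_))
    rw [Pi.mul_apply, norm_mul, Complex.norm_real, mul_pow, Real.norm_eq_abs, sq_abs, enorm_mul,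
      Real.enorm_of_nonneg (sq_nonneg _), enorm_pow, enorm_norm, mul_comm]
    rfl
  · intro f
    have hf := mem_graph_mulOp.1 ((mulOp fun x => (q x : ℂ)).mem_graph f)
    rw [hdensity, integral_map hq.aemeasurable (by fun_prop),
      integral_withDensity_eq_integral_smul (hmeas f), inner_L2, ← integral_complex_ofReal]
    refine integral_congr_ae ?_
    filter_upwards [hf] with x hx
    rw [hx, mul_left_comm, RCLike.conj_mul, NNReal.smul_def, smul_eq_mul, mul_comm]
    push_cast
    rfl

end MulPVM

lemma operatorSpectrum_mulOp {q : ℝ → ℂ} (hq : Continuous q) :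
    operatorSpectrum (mulOp q) = closure (Set.range q) := by
  refine Set.Subset.antisymm (fun z hz => ?_) fun z hz => ?_
  · by_contra hcl
    obtain ⟨δ, hδ, hball⟩ := Metric.isOpen_iff.1 isClosed_closure.isOpen_compl z hcl
    refine notMem_operatorSpectrum_mulOp hq.measurable hδ (fun x => ?_) hz
    by_contra! hlt
    exact hball (mem_ball_iff_norm.2 hlt) (subset_closure ⟨x, rfl⟩)
  · refine mem_operatorSpectrum_mulOp hq.measurable fun ε hε => ?_
    obtain ⟨_, ⟨x, rfl⟩, hx⟩ := Metric.mem_closure_iff.1 hz ε hε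
    have hopen : IsOpen {x | ‖q x - z‖ < ε} := isOpen_lt (by fun_prop) continuous_const
    have hne : {x | ‖q x - z‖ < ε}.Nonempty := ⟨x, by rwa [dist_comm, dist_eq_norm] at hx⟩
    exact ((hopen.measure_pos volume hne).trans_le (measure_mono fun _ (h : ‖_‖ < ε) => h.le)).ne'

/-! ### The operator `|∇|` on the Fourier side -/

/-- The symbol `2 π |ξ|` of `|∇|`. -/
def freq (ξ : ℝ) : ℝ := 2 * Real.pi * |ξ|

lemma continuous_freq : Continuous freq := by
  unfold freq; fun_prop

lemma volume_preimage_freq {B : Set ℝ} (hB : volume B = 0) : volume (freq ⁻¹' B) = 0 := by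
  have hsub : freq ⁻¹' B ⊆
      ((2 * Real.pi) * ·) ⁻¹' B ∪ ((-(2 * Real.pi)) * ·) ⁻¹' B := fun ξ hξ =>
    (abs_choice ξ).imp (fun h => by simpa [freq, h] using hξ) (fun h => by simpa [freq, h] using hξ)
  refine measure_mono_null hsub ?_
  rw [measure_union_null_iff, Real.volume_preimage_mul_left Real.two_pi_pos.ne',
    Real.volume_preimage_mul_left (neg_ne_zero.2 Real.two_pi_pos.ne')]
  simp only [hB, mul_zero, and_self]

lemma quasiMeasurePreserving_freq : Measure.QuasiMeasurePreserving freq volume volume :=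
  ⟨continuous_freq.measurable, Measure.AbsolutelyContinuous.mk fun B hB h => by
    rw [Measure.map_apply continuous_freq.measurable hB]; exact volume_preimage_freq h⟩

lemma range_freq : Set.range freq = Set.Ici 0 := by
  refine Set.Subset.antisymm ?_ fun t ht => ⟨t / (2 * Real.pi), ?_⟩
  · rintro _ ⟨ξ, rfl⟩
    exact mul_nonneg Real.two_pi_pos.le (abs_nonneg ξ)
  · rw [freq, abs_of_nonneg (div_nonneg ht Real.two_pi_pos.le),
      mul_div_cancel₀ _ Real.two_pi_pos.ne']

lemma operatorSpectrum_mulOp_freq :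
    operatorSpectrum (mulOp fun ξ => (freq ξ : ℂ)) = Complex.ofReal '' Set.Ici 0 := by
  have hclosed : IsClosed (Complex.ofReal '' Set.Ici 0) :=
    Complex.isometry_ofReal.isClosedEmbedding.isClosedMap _ isClosed_Ici
  rw [operatorSpectrum_mulOp (Complex.continuous_ofReal.comp' continuous_freq),
    Set.range_comp' Complex.ofReal freq, range_freq, hclosed.closure_eq]

lemma mem_graph_absNabla {f g : L2} : (f, g) ∈ absNabla.graph ↔
    fourierL2 g =ᵐ[volume] fun ξ => (freq ξ : ℂ) * fourierL2 f ξ := by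
  refine (mem_graph_sandwich_iff ..).trans (Iff.trans ?_ mem_graph_mulOp)
  constructor
  · rintro ⟨h, hh, rfl⟩
    change (_, fourierL2 (fourierL2.symm h)) ∈ _
    rwa [fourierL2.apply_symm_apply]
  · exact fun h => ⟨_, h, fourierL2.symm_apply_apply g⟩

lemma isFormalAdjoint_absNabla : absNabla.IsFormalAdjoint absNabla := by
  refine isFormalAdjoint_self_iff.2 fun f f' g g' hf hg => ?_
  rw [← fourierL2.inner_map_map, ← fourierL2.inner_map_map f]
  exact isFormalAdjoint_self_iff.1 (isFormalAdjoint_mulOp freq) _ _ _ _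
    (mem_graph_mulOp.2 (mem_graph_absNabla.1 hf)) (mem_graph_mulOp.2 (mem_graph_absNabla.1 hg))

/-! ### The Hardy space -/

lemma fourierL2_projPos (f : L2) :
    fourierL2 (projPos f) =ᵐ[volume] (Set.Ici 0).indicator (fourierL2 f) := by
  have h : fourierL2 (projPos f) = indicatorL2 measurableSet_Ici (fourierL2 f) :=
    fourierL2.apply_symm_apply _
  exact h ▸ coeFn_indicatorL2 measurableSet_Ici (fourierL2 f)

lemma isStarProjection_projPos : IsStarProjection projPos where
  isIdempotentElem := ContinuousLinearMap.ext fun f => fourierL2.injective <| Lp.ext <| by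
    filter_upwards [fourierL2_projPos (projPos f), fourierL2_projPos f] with ξ h₁ h₂
    change fourierL2 (projPos (projPos f)) ξ = _
    by_cases hξ : ξ ∈ Set.Ici 0 <;> simp [h₁, h₂, hξ]
  isSelfAdjoint := isSelfAdjoint_iff_isSymmetric.2 fun f g => by
    change ⟪projPos f, g⟫_ℂ = ⟪f, projPos g⟫_ℂ
    rw [← fourierL2.inner_map_map, ← fourierL2.inner_map_map f, inner_L2, inner_L2]
    refine integral_congr_ae ?_
    filter_upwards [fourierL2_projPos f, fourierL2_projPos g] with ξ h₁ h₂
    by_cases hξ : ξ ∈ Set.Ici 0 <;> simp [h₁, h₂, hξ]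

/-- The Hardy space of functions with nonnegative Fourier frequencies. -/
def hardy : Submodule ℂ L2 := projPos.range

instance : hardy.HasOrthogonalProjection :=
  (isStarProjection_iff_eq_starProjection_range.1 isStarProjection_projPos).elim fun h _ => h

lemma projPos_eq_starProjection : projPos = hardy.starProjection :=
  (isStarProjection_iff_eq_starProjection_range.1 isStarProjection_projPos).elim fun _ h => h

lemma projNeg_eq_starProjection : projNeg = hardyᗮ.starProjection := by
  rw [projNeg, projPos_eq_starProjection]
  exact hardy.starProjection_orthogonal'.symm

lemma projPos_add_projNeg (f : L2) : projPos f + projNeg f = f :=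
  add_sub_cancel (projPos f) f

lemma projPos_mem_hardy (f : L2) : projPos f ∈ hardy := ⟨f, rfl⟩

lemma projNeg_mem_orthogonal_hardy (f : L2) : projNeg f ∈ hardyᗮ := by
  rw [projNeg_eq_starProjection]
  exact Submodule.starProjection_apply_mem _ f

lemma projPos_eq_self_iff {f : L2} : projPos f = f ↔ f ∈ hardy := by
  rw [projPos_eq_starProjection, Submodule.starProjection_eq_self_iff]

lemma projPos_eq_zero_iff {f : L2} : projPos f = 0 ↔ f ∈ hardyᗮ := by
  rw [projPos_eq_starProjection, Submodule.starProjection_apply_eq_zero_iff]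

lemma projNeg_eq_self_iff {f : L2} : projNeg f = f ↔ f ∈ hardyᗮ := by
  rw [projNeg_eq_starProjection, Submodule.starProjection_eq_self_iff]

lemma projNeg_eq_zero_iff {f : L2} : projNeg f = 0 ↔ f ∈ hardy := by
  rw [projNeg_eq_starProjection, Submodule.starProjection_apply_eq_zero_iff,
    Submodule.orthogonal_orthogonal]

lemma mem_hardy_iff_fourierL2 {f : L2} : f ∈ hardy ↔ ∀ᵐ ξ, ξ < 0 → fourierL2 f ξ = 0 := by
  rw [← projPos_eq_self_iff, ← fourierL2.injective.eq_iff, Lp.ext_iff]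
  refine Filter.eventually_congr ?_
  filter_upwards [fourierL2_projPos f] with ξ h
  by_cases hξ : 0 ≤ ξ
  · simp [h, hξ]
  · simp [h, hξ, not_le.1 hξ, eq_comm]

lemma mem_orthogonal_hardy_iff_fourierL2 {f : L2} :
    f ∈ hardyᗮ ↔ ∀ᵐ ξ, 0 ≤ ξ → fourierL2 f ξ = 0 := by
  rw [← projPos_eq_zero_iff, ← fourierL2.map_eq_zero_iff, Lp.eq_zero_iff_ae_eq_zero]
  refine Filter.eventually_congr ?_
  filter_upwards [fourierL2_projPos f] with ξ h
  by_cases hξ : 0 ≤ ξ <;> simp [h, hξ]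

/-! ### Multiplication by `Q_m` -/

lemma Q_add (m n : ℕ) (x : ℝ) : Q (m + n) x = Q m x * Q n x := pow_add _ _ _

lemma Q_mul_conj_Q (m : ℕ) (x : ℝ) : Q m x * (starRingEnd ℂ) (Q m x) = 1 := by
  rw [Complex.mul_conj', norm_Q, Complex.ofReal_one, one_pow]

lemma conj_Q_mul_Q (m : ℕ) (x : ℝ) : (starRingEnd ℂ) (Q m x) * Q m x = 1 :=
  (mul_comm _ _).trans (Q_mul_conj_Q m x)

lemma mulQ_mulQ (m n : ℕ) (f : L2) : mulQ m (mulQ n f) = mulQ (m + n) f :=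
  mulBdd_mulBdd (fun x => (Q_add m n x).symm) f

lemma mulQ_zero (f : L2) : mulQ 0 f = f := mulBdd_eq_self (fun _ => pow_zero _) f

lemma mulQConj_mulQ (m : ℕ) (f : L2) : mulQConj m (mulQ m f) = f :=
  mulBdd_mulBdd_eq_self (conj_Q_mul_Q m) f

lemma mulQ_mulQConj (m : ℕ) (f : L2) : mulQ m (mulQConj m f) = f :=
  mulBdd_mulBdd_eq_self (Q_mul_conj_Q m) f

lemma inner_mulQ_left (m : ℕ) (f g : L2) : ⟪mulQ m f, g⟫_ℂ = ⟪f, mulQConj m g⟫_ℂ :=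
  inner_mulBdd_left (fun _ => rfl) f g

lemma inner_mulQConj_left (m : ℕ) (f g : L2) : ⟪mulQConj m f, g⟫_ℂ = ⟪f, mulQ m g⟫_ℂ :=
  inner_mulBdd_left (fun _ => (Complex.conj_conj _).symm) f g

lemma inner_mulQ_mulQ (m : ℕ) (f g : L2) : ⟪mulQ m f, mulQ m g⟫_ℂ = ⟪f, g⟫_ℂ := by
  rw [inner_mulQ_left, mulQConj_mulQ]

lemma inner_mulQConj_mulQConj (m : ℕ) (f g : L2) :
    ⟪mulQConj m f, mulQConj m g⟫_ℂ = ⟪f, g⟫_ℂ := by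
  rw [inner_mulQConj_left, mulQ_mulQConj]

/-! ### Cauchy kernels -/

/-- The exponential `e^{2 π i τ ξ}` on the half-line `ξ ≥ 0`: up to a constant, the Fourier
transform of the Cauchy kernel at `τ`. -/
def halfExp (τ : UpperHalfPlane) : ℝ → ℂ :=
  (Set.Ici 0).indicator fun ξ => Complex.exp (2 * Real.pi * Complex.I * τ * ξ)

lemma re_two_pi_I_mul_lt_zero {z : ℂ} (hz : 0 < z.im) : (2 * Real.pi * Complex.I * z).re < 0 := by
  have h : (2 * Real.pi * Complex.I * z).re = -(2 * Real.pi * z.im) := by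
    simp only [Complex.mul_re, Complex.mul_im, Complex.I_re, Complex.I_im, Complex.re_ofNat,
      Complex.im_ofNat, Complex.ofReal_re, Complex.ofReal_im]
    ring
  rw [h, neg_lt_zero]
  exact mul_pos Real.two_pi_pos hz

lemma integral_indicator_Ici_exp {z : ℂ} (hz : 0 < z.im) :
    ∫ ξ, (Set.Ici (0 : ℝ)).indicator
      (fun ξ : ℝ => Complex.exp (2 * Real.pi * Complex.I * z * ξ)) ξ =
      Complex.I / (2 * Real.pi) * z⁻¹ := by
  rw [integral_indicator measurableSet_Ici, integral_Ici_eq_integral_Ioi,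
    integral_exp_mul_complex_Ioi (re_two_pi_I_mul_lt_zero hz), Complex.ofReal_zero, mul_zero,
    Complex.exp_zero, neg_div, one_div, mul_inv, mul_inv, Complex.inv_I]
  ring

lemma measurable_halfExp (τ : UpperHalfPlane) : Measurable (halfExp τ) :=
  Measurable.indicator (by fun_prop) measurableSet_Ici

lemma integrable_halfExp (τ : UpperHalfPlane) : Integrable (halfExp τ) := by
  rw [halfExp, integrable_indicator_iff measurableSet_Ici, integrableOn_Ici_iff_integrableOn_Ioi]
  exact integrableOn_exp_mul_complex_Ioi (re_two_pi_I_mul_lt_zero τ.im_pos) 0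

lemma norm_halfExp_le_one (τ : UpperHalfPlane) (ξ : ℝ) : ‖halfExp τ ξ‖ ≤ 1 := by
  by_cases hξ : ξ ∈ Set.Ici 0
  · rw [halfExp, Set.indicator_of_mem hξ, Complex.norm_exp, Real.exp_le_one_iff,
      Complex.re_mul_ofReal]
    exact mul_nonpos_of_nonpos_of_nonneg (re_two_pi_I_mul_lt_zero τ.im_pos).le hξ
  · rw [halfExp, Set.indicator_of_notMem hξ, norm_zero]
    exact zero_le_one

lemma memLp_halfExp (τ : UpperHalfPlane) : MemLp (halfExp τ) 2 := by
  rw [memLp_two_iff_integrable_sq_norm (measurable_halfExp τ).aestronglyMeasurable]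
  refine (integrable_halfExp τ).norm.mono'
    ((measurable_halfExp τ).norm.pow_const 2).aestronglyMeasurable (.of_forall fun ξ => ?_)
  rw [norm_pow, norm_norm]
  exact pow_le_of_le_one (norm_nonneg _) (norm_halfExp_le_one τ ξ) two_ne_zero

lemma fourierInv_halfExp (τ : UpperHalfPlane) (x : ℝ) :
    𝓕⁻ (halfExp τ) x = Complex.I / (2 * Real.pi) * ((x : ℂ) + τ)⁻¹ := by
  have him : 0 < ((x : ℂ) + τ).im := by simpa using τ.im_pos
  rw [Real.fourierInv_eq', ← integral_indicator_Ici_exp him]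
  refine integral_congr_ae (.of_forall fun ξ => ?_)
  by_cases hξ : ξ ∈ Set.Ici (0 : ℝ)
  · simp only [halfExp, Set.indicator_of_mem hξ, smul_eq_mul, ← Complex.exp_add,
      RCLike.inner_apply, conj_trivial]
    push_cast
    ring_nf
  · simp only [halfExp, Set.indicator_of_notMem hξ, smul_zero]

lemma fourierL2_symm_eq_of_fourierInv {u : ℝ → ℂ} (hu1 : Integrable u) (hu2 : MemLp u 2) {v : L2}
    (hv : (v : ℝ → ℂ) =ᵐ[volume] 𝓕⁻ u) : fourierL2.symm (hu2.toLp u) = v := by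
  have hinj : Function.Injective (Lp.toTemperedDistributionCLM ℂ (volume : Measure ℝ) 2) :=
    LinearMap.ker_eq_bot.1 Lp.ker_toTemperedDistributionCLM_eq_bot
  refine hinj ?_
  have hflip : (-innerₗ ℝ : ℝ →ₗ[ℝ] ℝ →ₗ[ℝ] ℝ).flip = -innerₗ ℝ := by
    ext; simp
  have hdist := Lp.fourierInv_toTemperedDistribution_eq (hu2.toLp u)
  rw [Lp.toTemperedDistributionCLM_apply, Lp.toTemperedDistributionCLM_apply]
  change ((𝓕⁻ (hu2.toLp u) : L2) : TemperedDistribution ℝ ℂ) = _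
  rw [← hdist]
  ext φ
  rw [TemperedDistribution.fourierInv_apply, Lp.toTemperedDistribution_apply,
    Lp.toTemperedDistribution_apply]
  calc ∫ x, (𝓕⁻ φ) x • (hu2.toLp u) x = ∫ x, 𝓕⁻ (φ : ℝ → ℂ) x • u x := by
        refine integral_congr_ae ?_
        filter_upwards [hu2.coeFn_toLp] with x hx
        rw [hx, SchwartzMap.fourierInv_coe]
    _ = ∫ x, φ x • 𝓕⁻ u x := by
        have hmul := VectorFourier.integral_fourierIntegral_smul_eq_flip (L := -innerₗ ℝ)
          (μ := volume) (ν := volume) Real.continuous_fourierChar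
          (by simp only [LinearMap.neg_apply, innerₗ_apply_apply]; exact continuous_inner.neg)
          φ.integrable hu1
        rwa [hflip] at hmul
    _ = ∫ x, φ x • v x := integral_congr_ae (hv.mono fun x hx => congrArg (φ x • ·) hx.symm)

lemma add_coe_ne_zero (τ : UpperHalfPlane) (x : ℝ) : (x : ℂ) + τ ≠ 0 := fun h =>
  τ.im_pos.ne' (by simpa using congrArg Complex.im h)

lemma memLp_cauchyKernel (τ : UpperHalfPlane) : MemLp (fun x : ℝ => ((x : ℂ) + τ)⁻¹) 2 := by
  have hmeas : AEStronglyMeasurable (fun x : ℝ => ((x : ℂ) + τ)⁻¹) :=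
    (by fun_prop : Measurable fun x : ℝ => ((x : ℂ) + τ)⁻¹).aestronglyMeasurable
  rw [memLp_two_iff_integrable_sq_norm hmeas]
  have hint := ((integrable_inv_one_add_sq.comp_div τ.im_pos.ne').comp_add_right τ.re).const_mul
    (τ.im ^ 2)⁻¹
  refine hint.congr (.of_forall fun x => ?_)
  have him := τ.im_pos.ne'
  beta_reduce
  rw [norm_inv, inv_pow, ← Complex.normSq_eq_norm_sq, Complex.normSq_apply, ← mul_inv]
  simp only [Complex.add_re, Complex.ofReal_re, Complex.add_im, Complex.ofReal_im,
    UpperHalfPlane.coe_re, UpperHalfPlane.coe_im, zero_add]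
  congr 1
  field_simp
  ring

/-- The Cauchy kernel `x ↦ 1 / (x + τ)`. -/
def cauchyKernel (τ : UpperHalfPlane) : L2 := (memLp_cauchyKernel τ).toLp _

lemma coeFn_cauchyKernel (τ : UpperHalfPlane) :
    cauchyKernel τ =ᵐ[volume] fun x : ℝ => ((x : ℂ) + τ)⁻¹ := MemLp.coeFn_toLp _

lemma fourierL2_cauchyKernel (τ : UpperHalfPlane) :
    fourierL2 (cauchyKernel τ) =ᵐ[volume] fun ξ => -(2 * Real.pi * Complex.I) * halfExp τ ξ := by
  have hpi : (Real.pi : ℂ) ≠ 0 := Complex.ofReal_ne_zero.2 Real.pi_ne_zero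
  have h : fourierL2.symm ((memLp_halfExp τ).toLp _) =
      (Complex.I / (2 * Real.pi)) • cauchyKernel τ := by
    refine fourierL2_symm_eq_of_fourierInv (integrable_halfExp τ) _ ?_
    filter_upwards [Lp.coeFn_smul (Complex.I / (2 * Real.pi) : ℂ) (cauchyKernel τ),
      coeFn_cauchyKernel τ] with x h₁ h₂
    rw [h₁, Pi.smul_apply, h₂, smul_eq_mul, fourierInv_halfExp]
  rw [LinearIsometryEquiv.symm_apply_eq, map_smul] at h
  filter_upwards [(memLp_halfExp τ).coeFn_toLp, Lp.coeFn_smul (Complex.I / (2 * Real.pi) : ℂ)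
    (fourierL2 (cauchyKernel τ))] with ξ h₁ h₂
  rw [← h₁, h, h₂, Pi.smul_apply, smul_eq_mul]
  field_simp
  linear_combination fourierL2 (cauchyKernel τ) ξ * Complex.I_sq

lemma cauchyKernel_mem_hardy (τ : UpperHalfPlane) : cauchyKernel τ ∈ hardy := by
  rw [mem_hardy_iff_fourierL2]
  filter_upwards [fourierL2_cauchyKernel τ] with ξ h hξ
  rw [h, halfExp, Set.indicator_of_notMem (Set.notMem_Ici.2 hξ), mul_zero]

lemma inner_cauchyKernel_left (τ : UpperHalfPlane) (f : L2) :
    ⟪cauchyKernel τ, f⟫_ℂ =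
      2 * Real.pi * Complex.I * ∫ ξ, (starRingEnd ℂ) (halfExp τ ξ) * fourierL2 f ξ := by
  rw [← fourierL2.inner_map_map, inner_L2, ← integral_const_mul]
  refine integral_congr_ae ?_
  filter_upwards [fourierL2_cauchyKernel τ] with ξ h
  simp only [h, map_mul, map_neg, Complex.conj_I, Complex.conj_ofReal, map_ofNat]
  ring

lemma inner_cauchyKernel_cauchyKernel (σ τ : UpperHalfPlane) :
    ⟪cauchyKernel σ, cauchyKernel τ⟫_ℂ = 2 * Real.pi * Complex.I / (τ - (starRingEnd ℂ) σ) := by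
  have hpi : (Real.pi : ℂ) ≠ 0 := Complex.ofReal_ne_zero.2 Real.pi_ne_zero
  have him : 0 < ((τ : ℂ) - (starRingEnd ℂ) σ).im := by
    simpa using add_pos τ.im_pos σ.im_pos
  have hne : (τ : ℂ) - (starRingEnd ℂ) σ ≠ 0 := fun h => him.ne' (congrArg Complex.im h)
  have hint : ∫ ξ, (starRingEnd ℂ) (halfExp σ ξ) * fourierL2 (cauchyKernel τ) ξ =
      -(2 * Real.pi * Complex.I) * (Complex.I / (2 * Real.pi) * (τ - (starRingEnd ℂ) σ)⁻¹) := by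
    rw [← integral_indicator_Ici_exp him, ← integral_const_mul]
    refine integral_congr_ae ?_
    filter_upwards [fourierL2_cauchyKernel τ] with ξ h
    by_cases hξ : ξ ∈ Set.Ici (0 : ℝ)
    · simp only [h, halfExp, Set.indicator_of_mem hξ, ← Complex.exp_conj, map_mul, Complex.conj_I,
        Complex.conj_ofReal, map_ofNat]
      rw [mul_left_comm, ← Complex.exp_add]
      ring_nf
    · simp only [halfExp, Set.indicator_of_notMem hξ, map_zero, zero_mul, mul_zero]
  rw [inner_cauchyKernel_left, hint]
  field_simp
  linear_combination (-1 : ℂ) * Complex.I_sq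

lemma inner_cauchyKernel_vadd_I (x : ℝ) (f : L2) :
    ⟪cauchyKernel (-x +ᵥ UpperHalfPlane.I), f⟫_ℂ = 2 * Real.pi * Complex.I *
      𝓕⁻ (fun ξ => halfExp UpperHalfPlane.I ξ * fourierL2 f ξ) x := by
  rw [inner_cauchyKernel_left, Real.fourierInv_eq']
  congr 1
  refine integral_congr_ae (.of_forall fun ξ => ?_)
  by_cases hξ : ξ ∈ Set.Ici (0 : ℝ)
  · simp only [halfExp, Set.indicator_of_mem hξ, ← Complex.exp_conj, UpperHalfPlane.coe_vadd,
      UpperHalfPlane.coe_I, map_mul, map_add, Complex.conj_I, Complex.conj_ofReal, map_ofNat,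
      RCLike.inner_apply, conj_trivial, smul_eq_mul, ← mul_assoc, ← Complex.exp_add]
    push_cast
    ring_nf
  · simp only [halfExp, Set.indicator_of_notMem hξ, map_zero, zero_mul, smul_zero]

/-- The inner products with the kernels at `i - x`, `x ≠ 0`, already determine the inverse Fourier
transform of `e^{-2 π ξ} 𝓕 f`. -/
lemma mem_orthogonal_hardy_of_inner_cauchyKernel {f : L2}
    (h : ∀ τ ≠ UpperHalfPlane.I, ⟪cauchyKernel τ, f⟫_ℂ = 0) : f ∈ hardyᗮ := by
  let u : ℝ → ℂ := fun ξ => halfExp UpperHalfPlane.I ξ * fourierL2 f ξ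
  have hu₁ : Integrable u := (memLp_halfExp _).integrable_mul (Lp.memLp _)
  have hu₂ : MemLp u 2 := (Lp.memLp (fourierL2 f)).of_le_mul (c := 1)
    (hu₁.aestronglyMeasurable) (.of_forall fun ξ => by
      rw [norm_mul]
      exact mul_le_mul_of_nonneg_right (norm_halfExp_le_one _ ξ) (norm_nonneg _))
  have hu : ∀ x ≠ (0 : ℝ), 𝓕⁻ u x = 0 := fun x hx => by
    have hne : -x +ᵥ UpperHalfPlane.I ≠ UpperHalfPlane.I := fun hx' => hx (by
      simpa using congrArg UpperHalfPlane.re hx')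
    exact (mul_eq_zero.1 ((inner_cauchyKernel_vadd_I x f).symm.trans (h _ hne))).resolve_left
      Complex.two_pi_I_ne_zero
  have hzero : hu₂.toLp u = 0 := by
    rw [← fourierL2.symm.map_eq_zero_iff]
    refine fourierL2_symm_eq_of_fourierInv hu₁ hu₂ ?_
    filter_upwards [Lp.coeFn_zero ℂ 2 (volume : Measure ℝ), Measure.ae_ne volume 0] with x h₁ h₂
    rw [h₁, hu x h₂, Pi.zero_apply]
  rw [mem_orthogonal_hardy_iff_fourierL2]
  filter_upwards [hu₂.coeFn_toLp, Lp.eq_zero_iff_ae_eq_zero.1 hzero] with ξ h₁ h₂ hξ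
  refine (mul_eq_zero.1 (h₁.symm.trans h₂)).resolve_left ?_
  rw [halfExp, Set.indicator_of_mem (Set.mem_Ici.2 hξ)]
  exact Complex.exp_ne_zero _

/-! ### Multiplication by `Q_m` on the Hardy space -/

lemma mulQ_one_cauchyKernel {τ : UpperHalfPlane} (hτ : τ ≠ UpperHalfPlane.I) :
    mulQ 1 (cauchyKernel τ) = (Complex.I / (τ - Complex.I)) •
      ((τ + Complex.I) • cauchyKernel τ - (2 * Complex.I) • cauchyKernel UpperHalfPlane.I) := by
  have hne : (τ : ℂ) - Complex.I ≠ 0 := sub_ne_zero.2 fun h => hτ (UpperHalfPlane.ext h)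
  refine Lp.ext ?_
  filter_upwards [coeFn_mulBdd (cauchyKernel τ), coeFn_cauchyKernel τ,
    coeFn_cauchyKernel UpperHalfPlane.I,
    Lp.coeFn_smul (Complex.I / (τ - Complex.I)) ((τ + Complex.I) • cauchyKernel τ -
      (2 * Complex.I) • cauchyKernel UpperHalfPlane.I),
    Lp.coeFn_sub ((τ + Complex.I) • cauchyKernel τ)
      ((2 * Complex.I) • cauchyKernel UpperHalfPlane.I),
    Lp.coeFn_smul (τ + Complex.I) (cauchyKernel τ),
    Lp.coeFn_smul (2 * Complex.I) (cauchyKernel UpperHalfPlane.I)] with x h₁ h₂ h₃ h₄ h₅ h₆ h₇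
  rw [mulQ, h₁, h₄, Pi.smul_apply, h₅, Pi.sub_apply, h₆, h₇, Pi.smul_apply, Pi.smul_apply, h₂, h₃,
    Q, pow_one, UpperHalfPlane.coe_I]
  have hxτ := add_coe_ne_zero τ x
  have hxI := add_I_ne_zero x
  simp only [smul_eq_mul]
  field_simp
  ring

lemma inner_cauchyKernel_I_self :
    ⟪cauchyKernel UpperHalfPlane.I, cauchyKernel UpperHalfPlane.I⟫_ℂ = Real.pi := by
  rw [inner_cauchyKernel_cauchyKernel, UpperHalfPlane.coe_I, Complex.conj_I]
  have hI := Complex.I_ne_zero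
  rw [sub_neg_eq_add, ← two_mul, mul_right_comm,
    mul_div_cancel_left₀ _ (mul_ne_zero two_ne_zero hI)]

lemma inner_mulQ_one_cauchyKernel {τ : UpperHalfPlane} (hτ : τ ≠ UpperHalfPlane.I) (f : L2) :
    ⟪mulQ 1 (cauchyKernel τ), f⟫_ℂ =
      (starRingEnd ℂ) (Complex.I / (τ - Complex.I) * (τ + Complex.I)) *
        ⟪cauchyKernel τ, f - (⟪cauchyKernel UpperHalfPlane.I, f⟫_ℂ / Real.pi) •
          cauchyKernel UpperHalfPlane.I⟫_ℂ := by
  have hpi : (Real.pi : ℂ) ≠ 0 := Complex.ofReal_ne_zero.2 Real.pi_ne_zero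
  have hne : Complex.I - (starRingEnd ℂ) (τ : ℂ) ≠ 0 := fun h => by
    have him := congrArg Complex.im h
    simp only [Complex.sub_im, Complex.I_im, Complex.conj_im, sub_neg_eq_add,
      Complex.zero_im] at him
    exact (add_pos one_pos τ.im_pos).ne' him
  rw [mulQ_one_cauchyKernel hτ, inner_smul_left, inner_sub_left, inner_smul_left, inner_smul_left,
    inner_sub_right, inner_smul_right, inner_cauchyKernel_cauchyKernel, UpperHalfPlane.coe_I,
    map_mul _ (Complex.I / (τ - Complex.I))]
  generalize (starRingEnd ℂ) (Complex.I / (τ - Complex.I)) = c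
  simp only [map_add, map_mul, Complex.conj_I, Complex.conj_ofNat]
  field_simp
  ring

lemma mulQConj_one_mem_orthogonal_hardy {g : L2} (hg : g ∈ hardyᗮ) : mulQConj 1 g ∈ hardyᗮ := by
  refine mem_orthogonal_hardy_of_inner_cauchyKernel fun τ hτ => ?_
  rw [← inner_mulQ_left, mulQ_one_cauchyKernel hτ]
  refine Submodule.inner_right_of_mem_orthogonal (K := hardy) (hardy.smul_mem _ ?_) hg
  exact hardy.sub_mem (hardy.smul_mem _ (cauchyKernel_mem_hardy τ))
    (hardy.smul_mem _ (cauchyKernel_mem_hardy _))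

lemma mulQ_one_mem_hardy {f : L2} (hf : f ∈ hardy) : mulQ 1 f ∈ hardy := by
  rw [← hardy.orthogonal_orthogonal]
  refine (Submodule.mem_orthogonal _ _).2 fun g hg => ?_
  rw [← inner_mulQConj_left]
  exact Submodule.inner_left_of_mem_orthogonal hf (mulQConj_one_mem_orthogonal_hardy hg)

lemma mulQ_mem_hardy (m : ℕ) {f : L2} (hf : f ∈ hardy) : mulQ m f ∈ hardy := by
  induction m with
  | zero => rwa [mulQ_zero]
  | succ m ih =>
    rw [add_comm, ← mulQ_mulQ]
    exact mulQ_one_mem_hardy ih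

lemma mulQConj_mem_orthogonal_hardy (m : ℕ) {g : L2} (hg : g ∈ hardyᗮ) :
    mulQConj m g ∈ hardyᗮ := by
  refine (Submodule.mem_orthogonal _ _).2 fun f hf => ?_
  rw [← inner_mulQ_left]
  exact Submodule.inner_right_of_mem_orthogonal (mulQ_mem_hardy m hf) hg

lemma mulQConj_one_cauchyKernel_I_mem_orthogonal_hardy :
    mulQConj 1 (cauchyKernel UpperHalfPlane.I) ∈ hardyᗮ := by
  have hpi : (Real.pi : ℂ) ≠ 0 := Complex.ofReal_ne_zero.2 Real.pi_ne_zero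
  refine mem_orthogonal_hardy_of_inner_cauchyKernel fun τ hτ => ?_
  rw [← inner_mulQ_left, inner_mulQ_one_cauchyKernel hτ, inner_cauchyKernel_I_self,
    div_self hpi, one_smul, sub_self, inner_zero_right, mul_zero]

/-- The model space `H² ⊖ Q_n H²` of the inner function `Q_n`, as the functions `f` in the Hardy
space `H²` for which `conj Q_n f` is orthogonal to `H²`. -/
def modelSpace (n : ℕ) : Submodule ℂ L2 := hardy ⊓ hardyᗮ.comap (mulQConj n : L2 →ₗ[ℂ] L2)

lemma mem_modelSpace_iff {n : ℕ} {f : L2} :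
    f ∈ modelSpace n ↔ f ∈ hardy ∧ mulQConj n f ∈ hardyᗮ := Iff.rfl

lemma eq_smul_cauchyKernel_of_mem_modelSpace_one {f : L2} (hf : f ∈ modelSpace 1) :
    f = (⟪cauchyKernel UpperHalfPlane.I, f⟫_ℂ / Real.pi) • cauchyKernel UpperHalfPlane.I := by
  refine sub_eq_zero.1 (Submodule.disjoint_def.1 hardy.orthogonal_disjoint _
    (hardy.sub_mem hf.1 (hardy.smul_mem _ (cauchyKernel_mem_hardy _)))
    (mem_orthogonal_hardy_of_inner_cauchyKernel fun τ hτ => ?_))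
  have hne : (τ : ℂ) - Complex.I ≠ 0 := sub_ne_zero.2 fun h => hτ (UpperHalfPlane.ext h)
  have hadd : (τ : ℂ) + Complex.I ≠ 0 := fun h =>
    (add_pos τ.im_pos one_pos).ne' (by simpa using congrArg Complex.im h)
  have horth : ⟪mulQ 1 (cauchyKernel τ), f⟫_ℂ = 0 := by
    rw [inner_mulQ_left]
    exact Submodule.inner_right_of_mem_orthogonal (cauchyKernel_mem_hardy τ) hf.2
  rw [inner_mulQ_one_cauchyKernel hτ, mul_eq_zero, map_eq_zero] at horth
  exact horth.resolve_left
    (mul_ne_zero (div_ne_zero Complex.I_ne_zero hne) hadd)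

lemma mulQConj_one_mem_hardy {f : L2} (hf : f ∈ hardy)
    (h : ⟪cauchyKernel UpperHalfPlane.I, f⟫_ℂ = 0) : mulQConj 1 f ∈ hardy := by
  rw [← hardy.orthogonal_orthogonal]
  refine (Submodule.mem_orthogonal _ _).2 fun g hg => ?_
  have hmodel : projPos (mulQ 1 g) ∈ modelSpace 1 := by
    refine ⟨projPos_mem_hardy _, ?_⟩
    have hsub : mulQConj 1 (projPos (mulQ 1 g)) = g - mulQConj 1 (projNeg (mulQ 1 g)) := by
      rw [eq_sub_iff_add_eq, ← map_add, projPos_add_projNeg, mulQConj_mulQ]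
    change mulQConj 1 _ ∈ hardyᗮ
    exact hsub ▸ hardyᗮ.sub_mem hg
      (mulQConj_one_mem_orthogonal_hardy (projNeg_mem_orthogonal_hardy _))
  rw [← inner_mulQ_left, ← projPos_add_projNeg (mulQ 1 g), inner_add_left,
    Submodule.inner_left_of_mem_orthogonal hf (projNeg_mem_orthogonal_hardy _), add_zero,
    eq_smul_cauchyKernel_of_mem_modelSpace_one hmodel, inner_smul_left, h, mul_zero]

lemma mulQ_cauchyKernel_I_mem_modelSpace {k n : ℕ} (h : k < n) :
    mulQ k (cauchyKernel UpperHalfPlane.I) ∈ modelSpace n := by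
  refine ⟨mulQ_mem_hardy k (cauchyKernel_mem_hardy _),
    (Submodule.mem_orthogonal _ _).2 fun g hg => ?_⟩
  obtain ⟨j, rfl⟩ : ∃ j, n = k + (1 + j) := ⟨n - k - 1, by omega⟩
  change ⟪g, mulQConj _ _⟫_ℂ = 0
  rw [← inner_mulQ_left, ← mulQ_mulQ, inner_mulQ_mulQ, ← mulQ_mulQ, inner_mulQ_left]
  exact Submodule.inner_right_of_mem_orthogonal (mulQ_mem_hardy j hg)
    mulQConj_one_cauchyKernel_I_mem_orthogonal_hardy

lemma mulQConj_one_mem_modelSpace {n : ℕ} {f : L2} (hf : f ∈ modelSpace (n + 1))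
    (h : ⟪cauchyKernel UpperHalfPlane.I, f⟫_ℂ = 0) : mulQConj 1 f ∈ modelSpace n := by
  refine ⟨mulQConj_one_mem_hardy hf.1 h, (Submodule.mem_orthogonal _ _).2 fun g hg => ?_⟩
  change ⟪g, mulQConj _ _⟫_ℂ = 0
  rw [← inner_mulQ_left, ← inner_mulQ_left, mulQ_mulQ, add_comm, inner_mulQ_left]
  exact Submodule.inner_right_of_mem_orthogonal hg hf.2

/-- The `Q_k / (x + i)` are the Malmquist-Takenaka functions with all poles at `-i`. -/
lemma modelSpace_eq_span (n : ℕ) : modelSpace n =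
    Submodule.span ℂ (Set.range fun k : Fin n => mulQ k (cauchyKernel UpperHalfPlane.I)) := by
  refine le_antisymm ?_ (Submodule.span_le.2 ?_)
  · induction n with
    | zero =>
      intro f hf
      have hf₀ : mulQConj 0 f = f := by rw [← mulQ_zero (mulQConj 0 f), mulQ_mulQConj]
      have hzero : f = 0 := Submodule.disjoint_def.1 hardy.orthogonal_disjoint f hf.1
        (hf₀ ▸ (mem_modelSpace_iff.1 hf).2)
      exact hzero ▸ Submodule.zero_mem _
    | succ n ih =>
      intro f hf
      let k₀ := cauchyKernel UpperHalfPlane.I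
      let c := ⟪k₀, f⟫_ℂ / Real.pi
      have hk₀ : k₀ ∈ modelSpace (n + 1) :=
        mulQ_zero k₀ ▸ mulQ_cauchyKernel_I_mem_modelSpace n.succ_pos
      have horth : ⟪k₀, f - c • k₀⟫_ℂ = 0 := by
        rw [inner_sub_right, inner_smul_right, inner_cauchyKernel_I_self,
          div_mul_cancel₀ _ (Complex.ofReal_ne_zero.2 Real.pi_ne_zero), sub_self]
      have hspan := ih (mulQConj_one_mem_modelSpace
        ((modelSpace (n + 1)).sub_mem hf ((modelSpace (n + 1)).smul_mem c hk₀)) horth)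
      have hshift : (Submodule.span ℂ (Set.range fun k : Fin n => mulQ k k₀)).map
          (mulQ 1 : L2 →ₗ[ℂ] L2) ≤
          Submodule.span ℂ (Set.range fun k : Fin (n + 1) => mulQ k k₀) := by
        rw [Submodule.map_span_le]
        rintro _ ⟨k, rfl⟩
        exact Submodule.subset_span ⟨k.succ, by simp [mulQ_mulQ, add_comm]⟩
      have hmem := Submodule.add_mem _ (hshift ⟨_, hspan, mulQ_mulQConj 1 (f - c • k₀)⟩)
        (Submodule.smul_mem _ c (Submodule.subset_span ⟨0, mulQ_zero k₀⟩))
      rwa [sub_add_cancel] at hmem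
  · rintro _ ⟨k, rfl⟩
    exact mulQ_cauchyKernel_I_mem_modelSpace k.2

instance (n : ℕ) : FiniteDimensional ℂ (modelSpace n) := by
  rw [modelSpace_eq_span]
  exact FiniteDimensional.span_of_finite ℂ (Set.finite_range _)

/-! ### The gauge transform -/

lemma gaugeU_apply (m : ℕ) (f : L2) :
    gaugeU m f = mulQ m (projPos f) + mulQConj m (projNeg f) := rfl

lemma gaugeU_of_mem_hardy (m : ℕ) {f : L2} (hf : f ∈ hardy) : gaugeU m f = mulQ m f := by
  rw [gaugeU_apply, projPos_eq_self_iff.2 hf, projNeg_eq_zero_iff.2 hf, map_zero, add_zero]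

lemma gaugeU_of_mem_orthogonal_hardy (m : ℕ) {f : L2} (hf : f ∈ hardyᗮ) :
    gaugeU m f = mulQConj m f := by
  rw [gaugeU_apply, projPos_eq_zero_iff.2 hf, projNeg_eq_self_iff.2 hf, map_zero, zero_add]

lemma projPos_gaugeU (m : ℕ) (f : L2) : projPos (gaugeU m f) = mulQ m (projPos f) := by
  rw [gaugeU_apply, map_add, projPos_eq_self_iff.2 (mulQ_mem_hardy m (projPos_mem_hardy f)),
    projPos_eq_zero_iff.2 (mulQConj_mem_orthogonal_hardy m (projNeg_mem_orthogonal_hardy f)),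
    add_zero]

lemma projNeg_gaugeU (m : ℕ) (f : L2) : projNeg (gaugeU m f) = mulQConj m (projNeg f) := by
  rw [gaugeU_apply, map_add, projNeg_eq_zero_iff.2 (mulQ_mem_hardy m (projPos_mem_hardy f)),
    projNeg_eq_self_iff.2 (mulQConj_mem_orthogonal_hardy m (projNeg_mem_orthogonal_hardy f)),
    zero_add]

lemma mulQConj_projPos_add_mulQ_projNeg_gaugeU (m : ℕ) (f : L2) :
    mulQConj m (projPos (gaugeU m f)) + mulQ m (projNeg (gaugeU m f)) = f := by
  rw [projPos_gaugeU, projNeg_gaugeU, mulQConj_mulQ, mulQ_mulQConj, projPos_add_projNeg]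

lemma inner_add_add_hardy {f₁ f₂ g₁ g₂ : L2} (hf₁ : f₁ ∈ hardy) (hf₂ : f₂ ∈ hardyᗮ)
    (hg₁ : g₁ ∈ hardy) (hg₂ : g₂ ∈ hardyᗮ) :
    ⟪f₁ + f₂, g₁ + g₂⟫_ℂ = ⟪f₁, g₁⟫_ℂ + ⟪f₂, g₂⟫_ℂ := by
  rw [inner_add_left, inner_add_right, inner_add_right,
    Submodule.inner_right_of_mem_orthogonal hf₁ hg₂,
    Submodule.inner_left_of_mem_orthogonal hg₁ hf₂, add_zero, zero_add]

lemma inner_gaugeU_gaugeU (m : ℕ) (f g : L2) : ⟪gaugeU m f, gaugeU m g⟫_ℂ = ⟪f, g⟫_ℂ := by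
  have hP (f : L2) := projPos_mem_hardy f
  have hN (f : L2) := projNeg_mem_orthogonal_hardy f
  calc ⟪gaugeU m f, gaugeU m g⟫_ℂ
      = ⟪mulQ m (projPos f), mulQ m (projPos g)⟫_ℂ +
          ⟪mulQConj m (projNeg f), mulQConj m (projNeg g)⟫_ℂ :=
        inner_add_add_hardy (mulQ_mem_hardy m (hP f)) (mulQConj_mem_orthogonal_hardy m (hN f))
          (mulQ_mem_hardy m (hP g)) (mulQConj_mem_orthogonal_hardy m (hN g))
    _ = ⟪projPos f + projNeg f, projPos g + projNeg g⟫_ℂ := by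
        rw [inner_mulQ_mulQ, inner_mulQConj_mulQConj,
          inner_add_add_hardy (hP f) (hN f) (hP g) (hN g)]
    _ = ⟪f, g⟫_ℂ := by rw [projPos_add_projNeg, projPos_add_projNeg]

/-- The gauge transform `U` as a linear isometry, which gives access to its range. -/
def gaugeIsometry (m : ℕ) : L2 →ₗᵢ[ℂ] L2 :=
  (gaugeU m : L2 →ₗ[ℂ] L2).isometryOfInner (inner_gaugeU_gaugeU m)

lemma gaugeIsometry_apply (m : ℕ) (f : L2) : gaugeIsometry m f = gaugeU m f := rfl

lemma adjoint_gaugeU_gaugeU (m : ℕ) (f : L2) : adjoint (gaugeU m) (gaugeU m f) = f :=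
  ext_inner_left ℂ fun g => by rw [adjoint_inner_right, inner_gaugeU_gaugeU]

lemma mem_rangePerp_gaugeIsometry_iff {m : ℕ} {f : L2} :
    f ∈ rangePerp (gaugeIsometry m) ↔ mulQ m f ∈ hardy ∧ mulQConj m f ∈ hardyᗮ := by
  simp only [mem_rangePerp_iff, gaugeIsometry_apply]
  constructor
  · intro h
    constructor
    · rw [← Submodule.orthogonal_orthogonal hardy, Submodule.mem_orthogonal]
      intro g hg
      rw [← inner_mulQConj_left, ← gaugeU_of_mem_orthogonal_hardy m hg, h]
    · rw [Submodule.mem_orthogonal]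
      intro g hg
      rw [← inner_mulQ_left, ← gaugeU_of_mem_hardy m hg, h]
  · rintro ⟨hpos, hneg⟩ u
    rw [gaugeU_apply, inner_add_left, inner_mulQ_left, inner_mulQConj_left,
      Submodule.inner_right_of_mem_orthogonal (projPos_mem_hardy u) hneg,
      Submodule.inner_left_of_mem_orthogonal hpos (projNeg_mem_orthogonal_hardy u), add_zero]

lemma mulQ_mem_modelSpace_iff {m : ℕ} {f : L2} :
    mulQ m f ∈ modelSpace (2 * m) ↔ f ∈ rangePerp (gaugeIsometry m) := by
  have h : mulQConj (2 * m) (mulQ m f) = mulQConj m f :=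
    mulBdd_mulBdd (fun x => by
      rw [two_mul, Q_add, map_mul, mul_assoc, conj_Q_mul_Q, mul_one]) f
  rw [mem_modelSpace_iff, h, mem_rangePerp_gaugeIsometry_iff]

instance (m : ℕ) : FiniteDimensional ℂ (rangePerp (gaugeIsometry m)) := by
  have h : rangePerp (gaugeIsometry m) ≤
      (modelSpace (2 * m)).map (mulQConj m : L2 →ₗ[ℂ] L2) := fun f hf =>
    ⟨mulQ m f, mulQ_mem_modelSpace_iff.2 hf, mulQConj_mulQ m f⟩
  exact Submodule.finiteDimensional_of_le h

/-! ### Weak derivatives in `L²(ℝ)` -/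

/-- `g` is the weak derivative of `f` in `L²(ℝ)`, tested against Schwartz functions. -/
def HasWeakDeriv (f g : L2) : Prop :=
  ∀ φ : SchwartzMap ℝ ℂ, ∫ x, deriv φ x * f x = -∫ x, φ x * g x

lemma integrable_schwartz_mul (φ : SchwartzMap ℝ ℂ) (f : L2) : Integrable (fun x => φ x * f x) :=
  (φ.memLp 2).integrable_mul (Lp.memLp f)

lemma integrable_deriv_schwartz_mul (φ : SchwartzMap ℝ ℂ) (f : L2) :
    Integrable (fun x => deriv φ x * f x) :=
  integrable_schwartz_mul (SchwartzMap.derivCLM ℂ ℂ φ) f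

lemma hasWeakDeriv_of_hasDerivAt {u u' : ℝ → ℂ} (hd : ∀ x, HasDerivAt u (u' x) x)
    (hu : MemLp u 2) (hu' : MemLp u' 2) : HasWeakDeriv (hu.toLp u) (hu'.toLp u') := by
  intro φ
  have hφu : Integrable (fun x => φ x * u x) := (φ.memLp 2).integrable_mul hu
  have hφu' : Integrable (fun x => φ x * u' x) := (φ.memLp 2).integrable_mul hu'
  have hφ'u : Integrable (fun x => deriv φ x * u x) :=
    ((SchwartzMap.derivCLM ℂ ℂ φ).memLp 2).integrable_mul hu
  have hparts := integral_mul_deriv_eq_deriv_mul_of_integrable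
    (fun _ _ => φ.differentiableAt.hasDerivAt) (fun x _ => hd x) hφu' hφ'u hφu
  calc ∫ x, deriv φ x * hu.toLp u x = ∫ x, deriv φ x * u x :=
        integral_congr_ae (hu.coeFn_toLp.mono fun x hx => by beta_reduce; rw [hx])
    _ = -∫ x, φ x * u' x := by rw [hparts, neg_neg]
    _ = -∫ x, φ x * hu'.toLp u' x :=
        congrArg Neg.neg
          (integral_congr_ae (hu'.coeFn_toLp.mono fun x hx => by beta_reduce; rw [hx]))

lemma HasWeakDeriv.mul {q q' : ℝ → ℂ} (hq : q.HasTemperateGrowth)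
    (hd : ∀ x, HasDerivAt q (q' x) x) {f g u v : L2} (h : HasWeakDeriv f g)
    (hu : u =ᵐ[volume] fun x => q x * f x)
    (hv : v =ᵐ[volume] fun x => q x * g x + q' x * f x) : HasWeakDeriv u v := by
  intro φ
  have hqφ : (SchwartzMap.smulLeftCLM ℂ q φ : ℝ → ℂ) = fun x => q x * φ x := by
    ext x
    rw [SchwartzMap.smulLeftCLM_apply_apply hq, smul_eq_mul]
  have hderiv (x : ℝ) :
      deriv (SchwartzMap.smulLeftCLM ℂ q φ) x = q' x * φ x + q x * deriv φ x := by
    rw [hqφ]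
    exact ((hd x).mul φ.differentiableAt.hasDerivAt).deriv
  have hf := h (SchwartzMap.smulLeftCLM ℂ q φ)
  rw [eq_neg_iff_add_eq_zero,
    ← integral_add (integrable_deriv_schwartz_mul _ _) (integrable_schwartz_mul _ _)] at hf ⊢
  rw [← hf]
  refine integral_congr_ae ?_
  filter_upwards [hu, hv] with x hux hvx
  rw [hux, hvx, hderiv, hqφ]
  ring

lemma hasWeakDeriv_iff_lineDerivOp {f g : L2} : HasWeakDeriv f g ↔
    LineDeriv.lineDerivOp (1 : ℝ) (f : TemperedDistribution ℝ ℂ) = g := by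
  have h (φ : SchwartzMap ℝ ℂ) : LineDeriv.lineDerivOp (1 : ℝ) (f : TemperedDistribution ℝ ℂ) φ =
      -∫ x, deriv φ x * f x := by
    rw [TemperedDistribution.lineDerivOp_apply_apply, map_neg, Lp.toTemperedDistribution_apply]
    rfl
  constructor
  · intro hfg
    ext φ
    rw [h, hfg, neg_neg, Lp.toTemperedDistribution_apply]
    rfl
  · intro hfg φ
    rw [← neg_eq_iff_eq_neg, ← h, hfg, Lp.toTemperedDistribution_apply]
    rfl

lemma ae_eq_of_integral_schwartz_mul_eq {u v : ℝ → ℂ} (hu : LocallyIntegrable u)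
    (hv : LocallyIntegrable v)
    (h : ∀ φ : SchwartzMap ℝ ℂ, ∫ x, φ x * u x = ∫ x, φ x * v x) : u =ᵐ[volume] v := by
  refine ae_eq_of_integral_contDiff_smul_eq hu hv fun χ hχ hcpt => ?_
  have hsupp : HasCompactSupport (Complex.ofRealCLM ∘ χ) := hcpt.comp_left rfl
  exact h (hsupp.toSchwartzMap (by fun_prop))

lemma fourier_toTemperedDistribution_lineDerivOp (f : L2) (φ : SchwartzMap ℝ ℂ) :
    𝓕 (LineDeriv.lineDerivOp (1 : ℝ) (f : TemperedDistribution ℝ ℂ)) φ =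
      ∫ ξ, φ ξ * (2 * Real.pi * Complex.I * ξ * fourierL2 f ξ) := by
  have hgrowth : (fun x : ℝ => ((inner ℝ x (1 : ℝ) : ℝ) : ℂ)).HasTemperateGrowth := by fun_prop
  have hf : 𝓕 (f : TemperedDistribution ℝ ℂ) = (fourierL2 f : L2) :=
    Lp.fourier_toTemperedDistribution_eq f
  rw [TemperedDistribution.fourier_lineDerivOp_eq, hf]
  change (2 * Real.pi * Complex.I) • ((TemperedDistribution.smulLeftCLM ℂ
      (fun x : ℝ => ((inner ℝ x (1 : ℝ) : ℝ) : ℂ))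
      ((fourierL2 f : L2) : TemperedDistribution ℝ ℂ)) φ) = _
  rw [TemperedDistribution.smulLeftCLM_apply_apply, Lp.toTemperedDistribution_apply,
    ← integral_smul]
  refine integral_congr_ae (.of_forall fun x => ?_)
  beta_reduce
  rw [SchwartzMap.smulLeftCLM_apply_apply hgrowth]
  simp only [smul_eq_mul, RCLike.inner_apply, conj_trivial, one_mul]
  ring

lemma hasWeakDeriv_iff_fourierL2 {f g : L2} : HasWeakDeriv f g ↔
    fourierL2 g =ᵐ[volume] fun ξ => 2 * Real.pi * Complex.I * ξ * fourierL2 f ξ := by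
  have hinj : Function.Injective (fun T : TemperedDistribution ℝ ℂ => 𝓕 T) :=
    Function.LeftInverse.injective FourierTransform.fourierInv_fourier_eq
  have hg : 𝓕 (g : TemperedDistribution ℝ ℂ) = (fourierL2 g : L2) :=
    Lp.fourier_toTemperedDistribution_eq g
  have hloc (u : L2) : LocallyIntegrable u := (Lp.memLp u).locallyIntegrable one_le_two
  rw [hasWeakDeriv_iff_lineDerivOp, ← hinj.eq_iff, hg]
  constructor
  · intro h
    refine ae_eq_of_integral_schwartz_mul_eq (hloc _)
      ((hloc (fourierL2 f)).continuous_smul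
        (g := fun ξ : ℝ => 2 * Real.pi * Complex.I * (ξ : ℂ)) (by fun_prop)) fun φ => ?_
    calc ∫ ξ, φ ξ * fourierL2 g ξ = (fourierL2 g : TemperedDistribution ℝ ℂ) φ :=
          (Lp.toTemperedDistribution_apply _ _).symm
      _ = _ := by rw [← h, fourier_toTemperedDistribution_lineDerivOp]
  · intro h
    ext φ
    rw [fourier_toTemperedDistribution_lineDerivOp, Lp.toTemperedDistribution_apply]
    exact integral_congr_ae (h.mono fun ξ hξ => by beta_reduce; rw [hξ, smul_eq_mul])

lemma norm_two_pi_I_mul (ξ : ℝ) (z : ℂ) :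
    ‖2 * Real.pi * Complex.I * ξ * z‖ = ‖(freq ξ : ℂ) * z‖ := by
  simp [freq, abs_of_pos Real.pi_pos]

lemma exists_hasWeakDeriv_iff {f : L2} : (∃ g, HasWeakDeriv f g) ↔ f ∈ absNabla.domain := by
  have hf := Lp.aestronglyMeasurable (fourierL2 f)
  change _ ↔ MemLp (fun ξ => (freq ξ : ℂ) * fourierL2 f ξ) 2 volume
  constructor
  · rintro ⟨g, hg⟩
    have hmem := (memLp_congr_ae (hasWeakDeriv_iff_fourierL2.1 hg)).1 (Lp.memLp _)
    refine hmem.mono (.mul (by unfold freq; fun_prop) hf) (.of_forall fun ξ => ?_)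
    exact (norm_two_pi_I_mul ξ _).ge
  · intro h
    have hmem : MemLp (fun ξ : ℝ => 2 * Real.pi * Complex.I * ξ * fourierL2 f ξ) 2 volume :=
      h.mono (.mul (by fun_prop) hf) (.of_forall fun ξ => (norm_two_pi_I_mul ξ _).le)
    refine ⟨fourierL2.symm (hmem.toLp _), hasWeakDeriv_iff_fourierL2.2 ?_⟩
    rw [LinearIsometryEquiv.apply_symm_apply]
    exact hmem.coeFn_toLp

lemma hasWeakDeriv_projPos {f g : L2} (h : HasWeakDeriv f g) :
    HasWeakDeriv (projPos f) (projPos g) := by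
  rw [hasWeakDeriv_iff_fourierL2] at *
  filter_upwards [h, fourierL2_projPos f, fourierL2_projPos g] with ξ hξ hf hg
  rw [hf, hg]
  by_cases h0 : ξ ∈ Set.Ici (0 : ℝ)
  · rw [Set.indicator_of_mem h0, Set.indicator_of_mem h0, hξ]
  · rw [Set.indicator_of_notMem h0, Set.indicator_of_notMem h0, mul_zero]

lemma HasWeakDeriv.sub {f f' g g' : L2} (h : HasWeakDeriv f g) (h' : HasWeakDeriv f' g') :
    HasWeakDeriv (f - f') (g - g') := by
  rw [hasWeakDeriv_iff_fourierL2] at *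
  rw [map_sub, map_sub]
  filter_upwards [h, h', Lp.coeFn_sub (fourierL2 f) (fourierL2 f'),
    Lp.coeFn_sub (fourierL2 g) (fourierL2 g')] with ξ hξ hξ' hf hg
  rw [hf, hg, Pi.sub_apply, Pi.sub_apply, hξ, hξ', mul_sub]

lemma hasWeakDeriv_projNeg {f g : L2} (h : HasWeakDeriv f g) :
    HasWeakDeriv (projNeg f) (projNeg g) :=
  h.sub (hasWeakDeriv_projPos h)

lemma HasWeakDeriv.mem_graph_absNabla_of_mem_hardy {f g : L2} (h : HasWeakDeriv f g)
    (hf : f ∈ hardy) : (f, (-Complex.I) • g) ∈ absNabla.graph := by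
  rw [mem_graph_absNabla, map_smul]
  filter_upwards [hasWeakDeriv_iff_fourierL2.1 h, Lp.coeFn_smul (-Complex.I) (fourierL2 g),
    mem_hardy_iff_fourierL2.1 hf] with ξ hξ hsmul hzero
  rw [hsmul, Pi.smul_apply, hξ, smul_eq_mul, freq]
  rcases lt_or_ge ξ 0 with h0 | h0
  · rw [hzero h0, mul_zero, mul_zero, mul_zero]
  · rw [abs_of_nonneg h0]
    push_cast
    linear_combination (-2 * Real.pi * ξ * fourierL2 f ξ : ℂ) * Complex.I_sq

lemma HasWeakDeriv.mem_graph_absNabla_of_mem_orthogonal_hardy {f g : L2} (h : HasWeakDeriv f g)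
    (hf : f ∈ hardyᗮ) : (f, Complex.I • g) ∈ absNabla.graph := by
  rw [mem_graph_absNabla, map_smul]
  filter_upwards [hasWeakDeriv_iff_fourierL2.1 h, Lp.coeFn_smul Complex.I (fourierL2 g),
    mem_orthogonal_hardy_iff_fourierL2.1 hf] with ξ hξ hsmul hzero
  rw [hsmul, Pi.smul_apply, hξ, smul_eq_mul, freq]
  rcases lt_or_ge ξ 0 with h0 | h0
  · rw [abs_of_neg h0]
    push_cast
    linear_combination (2 * Real.pi * ξ * fourierL2 f ξ : ℂ) * Complex.I_sq
  · rw [hzero h0, mul_zero, mul_zero, mul_zero]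

lemma HasWeakDeriv.projPos_add_projNeg_mem_graph {f d : L2} (h : HasWeakDeriv f d) :
    (f, (-Complex.I) • projPos d + Complex.I • projNeg d) ∈ absNabla.graph := by
  have := absNabla.graph.add_mem
    ((hasWeakDeriv_projPos h).mem_graph_absNabla_of_mem_hardy (projPos_mem_hardy f))
    ((hasWeakDeriv_projNeg h).mem_graph_absNabla_of_mem_orthogonal_hardy
      (projNeg_mem_orthogonal_hardy f))
  rwa [Prod.mk_add_mk, projPos_add_projNeg] at this

/-! ### The gauge transform and `|∇|` -/

lemma sub_I_ne_zero (x : ℝ) : (x : ℂ) - Complex.I ≠ 0 := by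
  rw [← norm_ne_zero_iff, norm_sub_I]
  exact norm_ne_zero_iff.2 (add_I_ne_zero x)

lemma one_add_sq_eq_add_I_mul_sub_I (x : ℝ) :
    (1 : ℂ) + x ^ 2 = (x + Complex.I) * (x - Complex.I) := by
  linear_combination Complex.I_sq

lemma hasTemperateGrowth_Q (m : ℕ) : (Q m).HasTemperateGrowth := by
  have hQ : Q m = (fun x : ℝ => Complex.I * (((x : ℂ) - Complex.I) * ((x : ℂ) - Complex.I) *
      (((1 + ‖x‖ ^ 2) ^ (-1 : ℝ) : ℝ) : ℂ))) ^ m := by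
    ext x
    have hfrac : ((x : ℂ) - Complex.I) / ((x : ℂ) + Complex.I) =
        ((x : ℂ) - Complex.I) * ((x : ℂ) - Complex.I) * (((1 + x ^ 2)⁻¹ : ℝ) : ℂ) := by
      have hadd := add_I_ne_zero x
      have hsub := sub_I_ne_zero x
      push_cast
      rw [one_add_sq_eq_add_I_mul_sub_I]
      field_simp
    rw [Pi.pow_apply, Q, hfrac, Real.rpow_neg_one, Real.norm_eq_abs, sq_abs]
  have hrpow := Function.hasTemperateGrowth_one_add_norm_sq_rpow ℝ (-1)
  rw [hQ]
  exact Function.HasTemperateGrowth.pow (by fun_prop) m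

lemma hasTemperateGrowth_conj_Q (m : ℕ) :
    (fun x => (starRingEnd ℂ) (Q m x)).HasTemperateGrowth :=
  Function.HasTemperateGrowth.comp (g := fun z : ℂ => (starRingEnd ℂ) z)
    (Complex.conjCLE : ℂ →L[ℝ] ℂ).hasTemperateGrowth (hasTemperateGrowth_Q m)

lemma hasDerivAt_Q (m : ℕ) (x : ℝ) :
    HasDerivAt (Q m) (Complex.I * ((2 * m / (1 + x ^ 2) : ℝ) : ℂ) * Q m x) x := by
  have hadd := add_I_ne_zero x
  have hsub := sub_I_ne_zero x
  have hid : HasDerivAt (fun x : ℝ => (x : ℂ)) 1 x := Complex.ofRealCLM.hasDerivAt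
  refine ((((hid.sub_const Complex.I).div (hid.add_const Complex.I) hadd).const_mul
    Complex.I).pow m).congr_deriv ?_
  rcases m with _ | k
  · simp
  · rw [Q, Nat.add_sub_cancel, pow_succ _ k, Pi.div_apply]
    push_cast
    rw [one_add_sq_eq_add_I_mul_sub_I]
    field_simp
    ring

lemma hasDerivAt_conj_Q (m : ℕ) (x : ℝ) :
    HasDerivAt (fun x => (starRingEnd ℂ) (Q m x))
      (-Complex.I * ((2 * m / (1 + x ^ 2) : ℝ) : ℂ) * (starRingEnd ℂ) (Q m x)) x := by
  refine ((Complex.conjCLE : ℂ →L[ℝ] ℂ).hasFDerivAt.comp_hasDerivAt x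
    (hasDerivAt_Q m x)).congr_deriv ?_
  change (starRingEnd ℂ) _ = _
  rw [map_mul, map_mul, Complex.conj_I, Complex.conj_ofReal]

lemma coeFn_potential (m : ℕ) (f : L2) :
    potential m f =ᵐ[volume] fun x => ((2 * m / (1 + x ^ 2) : ℝ) : ℂ) * f x :=
  coeFn_mulBdd f

lemma hasWeakDeriv_mulBdd {m : ℕ} {c : ℂ} {q : ℝ → ℂ} {hq : Measurable q} {C : ℝ}
    {hC : ∀ x, ‖q x‖ ≤ C} (hgrowth : q.HasTemperateGrowth)
    (hd : ∀ x, HasDerivAt q (c * ((2 * m / (1 + x ^ 2) : ℝ) : ℂ) * q x) x) {f g : L2}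
    (h : HasWeakDeriv f g) :
    HasWeakDeriv (mulBdd q hq C hC f)
      (mulBdd q hq C hC g + c • potential m (mulBdd q hq C hC f)) := by
  have hcoe (f : L2) := coeFn_mulBdd (hq := hq) (hC := hC) f
  refine h.mul hgrowth hd (hcoe f) ?_
  filter_upwards [Lp.coeFn_add (mulBdd q hq C hC g) (c • potential m (mulBdd q hq C hC f)),
    Lp.coeFn_smul c (potential m (mulBdd q hq C hC f)),
    coeFn_potential m (mulBdd q hq C hC f), hcoe f, hcoe g]
    with x hadd hsmul hpot hf hg
  rw [hadd, Pi.add_apply, hsmul, Pi.smul_apply, hpot, hf, hg, smul_eq_mul]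
  ring

lemma hasWeakDeriv_mulQ (m : ℕ) {f g : L2} (h : HasWeakDeriv f g) :
    HasWeakDeriv (mulQ m f) (mulQ m g + Complex.I • potential m (mulQ m f)) :=
  hasWeakDeriv_mulBdd (hasTemperateGrowth_Q m) (hasDerivAt_Q m) h

lemma hasWeakDeriv_mulQConj (m : ℕ) {f g : L2} (h : HasWeakDeriv f g) :
    HasWeakDeriv (mulQConj m f) (mulQConj m g + (-Complex.I) • potential m (mulQConj m f)) :=
  hasWeakDeriv_mulBdd (hasTemperateGrowth_conj_Q m) (hasDerivAt_conj_Q m) h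

lemma gaugeU_mem_graph_absNabla (m : ℕ) {f g : L2} (h : (f, g) ∈ absNabla.graph) :
    (gaugeU m f, gaugeU m g + potential m (gaugeU m f)) ∈ absNabla.graph := by
  obtain ⟨d, hd⟩ := exists_hasWeakDeriv_iff.2 (absNabla.mem_domain_of_mem_graph h)
  have hg : g = (-Complex.I) • projPos d + Complex.I • projNeg d :=
    absNabla.mem_graph_snd_inj h hd.projPos_add_projNeg_mem_graph rfl
  have hpos := (hasWeakDeriv_mulQ m
    (hasWeakDeriv_projPos hd)).mem_graph_absNabla_of_mem_hardy
      (mulQ_mem_hardy m (projPos_mem_hardy f))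
  have hneg := (hasWeakDeriv_mulQConj m
    (hasWeakDeriv_projNeg hd)).mem_graph_absNabla_of_mem_orthogonal_hardy
      (mulQConj_mem_orthogonal_hardy m (projNeg_mem_orthogonal_hardy f))
  convert absNabla.graph.add_mem hpos hneg using 1
  refine Prod.ext rfl ?_
  rw [hg, map_add, map_smul, map_smul, gaugeU_of_mem_hardy m (projPos_mem_hardy d),
    gaugeU_of_mem_orthogonal_hardy m (projNeg_mem_orthogonal_hardy d), gaugeU_apply, map_add]
  simp only [Prod.mk_add_mk, smul_add, smul_smul, neg_mul, mul_neg, Complex.I_mul_I, neg_neg,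
    one_smul]
  abel

lemma mulQ_mem_domain_absNabla (m : ℕ) {f : L2} (hf : f ∈ absNabla.domain) :
    mulQ m f ∈ absNabla.domain := by
  obtain ⟨d, hd⟩ := exists_hasWeakDeriv_iff.2 hf
  exact exists_hasWeakDeriv_iff.1 ⟨_, hasWeakDeriv_mulQ m hd⟩

lemma mulQConj_mem_domain_absNabla (m : ℕ) {f : L2} (hf : f ∈ absNabla.domain) :
    mulQConj m f ∈ absNabla.domain := by
  obtain ⟨d, hd⟩ := exists_hasWeakDeriv_iff.2 hf
  exact exists_hasWeakDeriv_iff.1 ⟨_, hasWeakDeriv_mulQConj m hd⟩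

lemma mem_domain_absNabla_of_gaugeU {m : ℕ} {f : L2} (h : gaugeU m f ∈ absNabla.domain) :
    f ∈ absNabla.domain := by
  obtain ⟨d, hd⟩ := exists_hasWeakDeriv_iff.2 h
  rw [← mulQConj_projPos_add_mulQ_projNeg_gaugeU m f]
  exact absNabla.domain.add_mem
    (mulQConj_mem_domain_absNabla m (exists_hasWeakDeriv_iff.1 ⟨_, hasWeakDeriv_projPos hd⟩))
    (mulQ_mem_domain_absNabla m (exists_hasWeakDeriv_iff.1 ⟨_, hasWeakDeriv_projNeg hd⟩))

lemma cauchyKernel_mem_domain_absNabla (τ : UpperHalfPlane) :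
    cauchyKernel τ ∈ absNabla.domain := by
  have hd (x : ℝ) :
      HasDerivAt (fun x : ℝ => ((x : ℂ) + τ)⁻¹) (-1 / ((x : ℂ) + τ) ^ 2) x :=
    (Complex.ofRealCLM.hasDerivAt.add_const (τ : ℂ)).inv (add_coe_ne_zero τ x)
  have hle (x : ℝ) : τ.im ≤ ‖(x : ℂ) + τ‖ := by
    simpa using (le_abs_self _).trans (Complex.abs_im_le_norm ((x : ℂ) + τ))
  have hmem : MemLp (fun x : ℝ => -1 / ((x : ℂ) + τ) ^ 2) 2 := by
    refine (memLp_cauchyKernel τ).of_le_mul (c := τ.im⁻¹)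
      (Measurable.aestronglyMeasurable (by fun_prop)) (.of_forall fun x => ?_)
    rw [norm_div, norm_neg, norm_one, norm_pow, norm_inv, one_div, sq, mul_inv]
    have := inv_anti₀ τ.im_pos (hle x)
    gcongr
  exact exists_hasWeakDeriv_iff.1
    ⟨_, hasWeakDeriv_of_hasDerivAt hd (memLp_cauchyKernel τ) hmem⟩

lemma modelSpace_le_domain_absNabla (n : ℕ) : modelSpace n ≤ absNabla.domain := by
  rw [modelSpace_eq_span, Submodule.span_le]
  rintro _ ⟨k, rfl⟩
  exact mulQ_mem_domain_absNabla _ (cauchyKernel_mem_domain_absNabla _)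

lemma rangePerp_gaugeIsometry_le_domain_absNabla (m : ℕ) :
    rangePerp (gaugeIsometry m) ≤ absNabla.domain := by
  intro f hf
  rw [← mulQConj_mulQ m f]
  exact mulQConj_mem_domain_absNabla m
    (modelSpace_le_domain_absNabla _ (mulQ_mem_modelSpace_iff.2 hf))

/-! ### The operator `R` has finite rank -/

lemma mulQConj_mulQConj (m n : ℕ) (f : L2) : mulQConj m (mulQConj n f) = mulQConj (m + n) f :=
  mulBdd_mulBdd (fun x => by rw [Q_add, map_mul]) f

lemma coeFn_mulQ (m : ℕ) (f : L2) : mulQ m f =ᵐ[volume] fun x => Q m x * f x :=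
  coeFn_mulBdd f

lemma coeFn_mulQConj (m : ℕ) (f : L2) :
    mulQConj m f =ᵐ[volume] fun x => (starRingEnd ℂ) (Q m x) * f x :=
  coeFn_mulBdd f

/-- The function `1 / (1 + x ^ 2)` in `L²(ℝ)`, written as a combination of Cauchy kernels. -/
def lorentzian : L2 :=
  (Complex.I / 2) • cauchyKernel UpperHalfPlane.I +
    (1 / 2 : ℂ) • mulQConj 1 (cauchyKernel UpperHalfPlane.I)

lemma mulQ_one_lorentzian_mem_hardy : mulQ 1 lorentzian ∈ hardy := by
  have hk := cauchyKernel_mem_hardy UpperHalfPlane.I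
  rw [lorentzian, map_add, map_smul, map_smul, mulQ_mulQConj]
  exact hardy.add_mem (hardy.smul_mem _ (mulQ_mem_hardy 1 hk)) (hardy.smul_mem _ hk)

lemma mulQConj_one_lorentzian_mem_orthogonal_hardy : mulQConj 1 lorentzian ∈ hardyᗮ := by
  have hk := mulQConj_one_cauchyKernel_I_mem_orthogonal_hardy
  rw [lorentzian, map_add, map_smul, map_smul]
  exact hardyᗮ.add_mem (hardyᗮ.smul_mem _ hk)
    (hardyᗮ.smul_mem _ (mulQConj_mem_orthogonal_hardy 1 hk))

lemma coeFn_lorentzian : lorentzian =ᵐ[volume] fun x => (((1 + x ^ 2)⁻¹ : ℝ) : ℂ) := by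
  set k := cauchyKernel UpperHalfPlane.I with hk
  filter_upwards [Lp.coeFn_add ((Complex.I / 2) • k) ((1 / 2 : ℂ) • mulQConj 1 k),
    Lp.coeFn_smul (Complex.I / 2) k, Lp.coeFn_smul (1 / 2 : ℂ) (mulQConj 1 k),
    coeFn_mulQConj 1 k, coeFn_cauchyKernel UpperHalfPlane.I]
    with x hadd hsmul hsmul' hconj hcauchy
  have hx := add_I_ne_zero x
  have hx' := sub_I_ne_zero x
  rw [lorentzian, ← hk, hadd, Pi.add_apply, hsmul, hsmul', Pi.smul_apply, Pi.smul_apply, hconj,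
    hcauchy, Q, pow_one, map_mul, map_div₀, map_add, map_sub, Complex.conj_I, Complex.conj_ofReal,
    UpperHalfPlane.coe_I, smul_eq_mul, smul_eq_mul, Complex.ofReal_inv, Complex.ofReal_add,
    Complex.ofReal_pow, Complex.ofReal_one, one_add_sq_eq_add_I_mul_sub_I, sub_neg_eq_add,
    ← sub_eq_add_neg]
  field_simp
  linear_combination -2 * Complex.I_sq

/-- The functions `Q_j conj(Q_k) / (1 + x ^ 2)`, which separate the variables in the kernel
of `R`. -/
def kernelFactor (j k : ℕ) : L2 := mulQ j (mulQConj k lorentzian)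

lemma coeFn_kernelFactor (j k : ℕ) : kernelFactor j k =ᵐ[volume]
    fun x => Q j x * ((starRingEnd ℂ) (Q k x) * (((1 + x ^ 2)⁻¹ : ℝ) : ℂ)) := by
  filter_upwards [coeFn_mulQ j (mulQConj k lorentzian), coeFn_mulQConj k lorentzian,
    coeFn_lorentzian] with x hj hk hx
  rw [kernelFactor, hj, hk, hx]

lemma kernelFactor_mem_rangePerp {m j k : ℕ} (hj : j < m) (hk : k < m) :
    kernelFactor j k ∈ rangePerp (gaugeIsometry m) := by
  rw [mem_rangePerp_gaugeIsometry_iff, kernelFactor]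
  constructor
  · rw [mulQ_mulQ, show m + j = (m - k - 1 + j) + 1 + k by omega, ← mulQ_mulQ, mulQ_mulQConj,
      ← mulQ_mulQ]
    exact mulQ_mem_hardy _ mulQ_one_lorentzian_mem_hardy
  · rw [show m = (m - j - 1) + 1 + j by omega, ← mulQConj_mulQConj, mulQConj_mulQ,
      mulQConj_mulQConj, add_right_comm, ← mulQConj_mulQConj]
    exact mulQConj_mem_orthogonal_hardy _ mulQConj_one_lorentzian_mem_orthogonal_hardy

lemma Q_one_sub_Q_one (x y : ℝ) : Q 1 x - Q 1 y =
    -2 * ((x - y : ℝ) : ℂ) / (((x : ℂ) + Complex.I) * ((y : ℂ) + Complex.I)) := by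
  have hx := add_I_ne_zero x
  have hy := add_I_ne_zero y
  rw [Q, Q, pow_one, pow_one]
  field_simp
  push_cast
  linear_combination (2 * (x - y) : ℂ) * Complex.I_sq

lemma norm_Q_one_sub_sq (x y : ℝ) :
    ‖Q 1 x - Q 1 y‖ ^ 2 = 4 * |x - y| ^ 2 / ((1 + x ^ 2) * (1 + y ^ 2)) := by
  rw [Q_one_sub_Q_one, norm_div, norm_mul, norm_mul, Complex.norm_real, div_pow, mul_pow, mul_pow,
    norm_add_I_sq, norm_add_I_sq, Real.norm_eq_abs, norm_neg, Complex.norm_ofNat]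
  norm_num

lemma Q_mul_conj_Q_eq_pow (k : ℕ) (x y : ℝ) :
    Q k x * (starRingEnd ℂ) (Q k y) = (Q 1 x * (starRingEnd ℂ) (Q 1 y)) ^ k := by
  rw [Q, Q, Q, Q, pow_one, pow_one, map_pow, ← mul_pow]

lemma norm_Q_sub (m : ℕ) (x y : ℝ) : ‖Q m x - Q m y‖ =
    ‖Q 1 x - Q 1 y‖ * ‖∑ k ∈ Finset.range m, Q k x * (starRingEnd ℂ) (Q k y)‖ := by
  have hnorm (k : ℕ) : ‖Q k x - Q k y‖ = ‖Q k x * (starRingEnd ℂ) (Q k y) - 1‖ := by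
    rw [show Q k x - Q k y = Q k y * (Q k x * (starRingEnd ℂ) (Q k y) - 1) by
      linear_combination (-Q k x) * conj_Q_mul_Q k y, norm_mul, norm_Q, one_mul]
  rw [Finset.sum_congr rfl fun k _ => Q_mul_conj_Q_eq_pow k x y, hnorm, hnorm,
    Q_mul_conj_Q_eq_pow m, ← mul_geom_sum, norm_mul]

lemma kernelR_eq_norm_sum_sq (m : ℕ) {x y : ℝ} (hxy : x ≠ y) :
    kernelR m x y = 2 / Real.pi * ((1 + x ^ 2)⁻¹ * (1 + y ^ 2)⁻¹) *
      ‖∑ k ∈ Finset.range m, Q k x * (starRingEnd ℂ) (Q k y)‖ ^ 2 := by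
  have hd : |x - y| ≠ 0 := abs_ne_zero.2 (sub_ne_zero.2 hxy)
  rw [kernelR, norm_Q_sub, mul_pow, norm_Q_one_sub_sq]
  field_simp
  ring

lemma kernelR_mul_eq_sum (m : ℕ) (f : L2) (x : ℝ) :
    (fun y => (kernelR m x y : ℂ) * f y) =ᵐ[volume] fun y => ∑ j ∈ Finset.range m,
      ∑ k ∈ Finset.range m, (2 / Real.pi *
        (Q j x * ((starRingEnd ℂ) (Q k x) * (((1 + x ^ 2)⁻¹ : ℝ) : ℂ)))) *
          ((starRingEnd ℂ) (kernelFactor j k y) * f y) := by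
  have hfactor : ∀ᵐ y : ℝ, ∀ j k, kernelFactor j k y =
      Q j y * ((starRingEnd ℂ) (Q k y) * (((1 + y ^ 2)⁻¹ : ℝ) : ℂ)) :=
    ae_all_iff.2 fun j => ae_all_iff.2 fun k => coeFn_kernelFactor j k
  filter_upwards [Measure.ae_ne volume x, hfactor] with y hy hfac
  rw [kernelR_eq_norm_sum_sq m hy.symm, Complex.ofReal_mul, Complex.ofReal_pow,
    ← Complex.mul_conj', map_sum, Finset.sum_mul_sum, Finset.mul_sum, Finset.sum_mul]
  refine Finset.sum_congr rfl fun j _ => ?_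
  rw [Finset.mul_sum, Finset.sum_mul]
  refine Finset.sum_congr rfl fun k _ => ?_
  rw [hfac]
  simp only [map_mul, Complex.conj_conj, Complex.conj_ofReal]
  push_cast
  ring

lemma integralR_eq_sum (m : ℕ) (f : L2) (x : ℝ) :
    integralR m f x = ∑ j ∈ Finset.range m, ∑ k ∈ Finset.range m,
      (2 / Real.pi * ⟪kernelFactor j k, f⟫_ℂ) *
        (Q j x * ((starRingEnd ℂ) (Q k x) * (((1 + x ^ 2)⁻¹ : ℝ) : ℂ))) := by
  have hint (j k : ℕ) (c : ℂ) :
      Integrable fun y => c * ((starRingEnd ℂ) (kernelFactor j k y) * f y) :=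
    ((Lp.memLp (kernelFactor j k)).star.integrable_mul (Lp.memLp f)).const_mul c
  rw [integralR, integral_congr_ae (kernelR_mul_eq_sum m f x),
    integral_finsetSum _ fun j _ => integrable_finsetSum _ fun k _ => hint j k _]
  refine Finset.sum_congr rfl fun j _ => ?_
  rw [integral_finsetSum _ fun k _ => hint j k _]
  refine Finset.sum_congr rfl fun k _ => ?_
  rw [integral_const_mul, inner_L2]
  ring

lemma opR_eq_sum (m : ℕ) (f : L2) : opR m f = ∑ j ∈ Finset.range m, ∑ k ∈ Finset.range m,
    (2 / Real.pi * ⟪kernelFactor j k, f⟫_ℂ) • kernelFactor j k := by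
  have hterm : ∀ᵐ x : ℝ, ∀ j k,
      ((2 / Real.pi * ⟪kernelFactor j k, f⟫_ℂ) • kernelFactor j k : L2) x =
        (2 / Real.pi * ⟪kernelFactor j k, f⟫_ℂ) *
          (Q j x * ((starRingEnd ℂ) (Q k x) * (((1 + x ^ 2)⁻¹ : ℝ) : ℂ))) := by
    refine ae_all_iff.2 fun j => ae_all_iff.2 fun k => ?_
    filter_upwards [Lp.coeFn_smul (2 / Real.pi * ⟪kernelFactor j k, f⟫_ℂ) (kernelFactor j k),
      coeFn_kernelFactor j k] with x hsmul hfactor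
    rw [hsmul, Pi.smul_apply, hfactor, smul_eq_mul]
  have hinner : ∀ᵐ x : ℝ, ∀ j,
      (∑ k ∈ Finset.range m, (2 / Real.pi * ⟪kernelFactor j k, f⟫_ℂ) • kernelFactor j k : L2) x =
        ∑ k ∈ Finset.range m,
          ((2 / Real.pi * ⟪kernelFactor j k, f⟫_ℂ) • kernelFactor j k : L2) x :=
    ae_all_iff.2 fun j => Lp.coeFn_fun_finsetSum _ _
  refine Lp.ext ?_
  filter_upwards [(memLp_integralR m f).coeFn_toLp, hterm, hinner,
    Lp.coeFn_fun_finsetSum (Finset.range m) fun j => ∑ k ∈ Finset.range m,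
      (2 / Real.pi * ⟪kernelFactor j k, f⟫_ℂ) • kernelFactor j k] with x hopR hterm hinner houter
  rw [houter]
  refine (hopR.trans (integralR_eq_sum m f x)).trans (Finset.sum_congr rfl fun j _ => ?_)
  rw [hinner]
  exact Finset.sum_congr rfl fun k _ => (hterm j k).symm

lemma inner_opR_left (m : ℕ) (f g : L2) : ⟪opR m f, g⟫_ℂ = ⟪f, opR m g⟫_ℂ := by
  simp only [opR_eq_sum, sum_inner, inner_sum, inner_smul_left, inner_smul_right, map_mul,
    map_div₀, Complex.conj_ofReal, Complex.conj_ofNat, inner_conj_symm]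
  refine Finset.sum_congr rfl fun j _ => Finset.sum_congr rfl fun k _ => ?_
  ring

lemma opR_gaugeU (m : ℕ) (f : L2) : opR m (gaugeU m f) = 0 := by
  rw [opR_eq_sum]
  refine Finset.sum_eq_zero fun j hj => Finset.sum_eq_zero fun k hk => ?_
  have hperp := kernelFactor_mem_rangePerp (Finset.mem_range.1 hj) (Finset.mem_range.1 hk)
  rw [← gaugeIsometry_apply, inner_eq_zero_symm.1 (mem_rangePerp_iff.1 hperp f), mul_zero,
    zero_smul]

/-! ### The operators `L₊` and `L₋` -/

lemma inner_potential_left (m : ℕ) (f g : L2) : ⟪potential m f, g⟫_ℂ = ⟪f, potential m g⟫_ℂ :=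
  inner_mulBdd_left (fun _ => (Complex.conj_ofReal _).symm) f g

lemma mem_graph_Lplus {m : ℕ} {f g : L2} :
    (f, g) ∈ (Lplus m).graph ↔ (f, g + potential m f) ∈ absNabla.graph := by
  constructor
  · intro h
    obtain ⟨u, rfl, rfl⟩ := (Lplus m).mem_graph_iff.1 h
    exact absNabla.mem_graph_iff.2 ⟨u, rfl, (sub_add_cancel ..).symm⟩
  · intro h
    obtain ⟨u, rfl, hu⟩ := absNabla.mem_graph_iff.1 h
    exact (Lplus m).mem_graph_iff.2 ⟨u, rfl, sub_eq_of_eq_add hu⟩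

lemma mem_graph_Lminus {m : ℕ} {f g : L2} :
    (f, g) ∈ (Lminus m).graph ↔ (f, g - opR m f) ∈ (Lplus m).graph := by
  constructor
  · intro h
    obtain ⟨u, rfl, rfl⟩ := (Lminus m).mem_graph_iff.1 h
    exact (Lplus m).mem_graph_iff.2 ⟨u, rfl, (add_sub_cancel_right ..).symm⟩
  · intro h
    obtain ⟨u, rfl, hu⟩ := (Lplus m).mem_graph_iff.1 h
    exact (Lminus m).mem_graph_iff.2 ⟨u, rfl, eq_sub_iff_add_eq.1 hu⟩

lemma isFormalAdjoint_Lplus (m : ℕ) : (Lplus m).IsFormalAdjoint (Lplus m) := by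
  refine isFormalAdjoint_self_iff.2 fun f f' g g' hf hg => ?_
  have h := isFormalAdjoint_self_iff.1 isFormalAdjoint_absNabla _ _ _ _
    (mem_graph_Lplus.1 hf) (mem_graph_Lplus.1 hg)
  rwa [inner_add_left, inner_add_right, inner_potential_left, add_left_inj] at h

lemma isFormalAdjoint_Lminus (m : ℕ) : (Lminus m).IsFormalAdjoint (Lminus m) := by
  refine isFormalAdjoint_self_iff.2 fun f f' g g' hf hg => ?_
  have h := isFormalAdjoint_self_iff.1 (isFormalAdjoint_Lplus m) _ _ _ _
    (mem_graph_Lminus.1 hf) (mem_graph_Lminus.1 hg)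
  rwa [inner_sub_left, inner_sub_right, inner_opR_left, sub_left_inj] at h

lemma intertwines_Lplus (m : ℕ) : Intertwines (gaugeIsometry m) absNabla (Lplus m) where
  map_graph h := mem_graph_Lplus.2 (gaugeU_mem_graph_absNabla m h)
  mem_domain h := mem_domain_absNabla_of_gaugeU h

lemma intertwines_Lminus (m : ℕ) : Intertwines (gaugeIsometry m) absNabla (Lminus m) where
  map_graph h := mem_graph_Lminus.2 <| by
    rw [gaugeIsometry_apply, opR_gaugeU, sub_zero]
    exact (intertwines_Lplus m).map_graph h
  mem_domain h := mem_domain_absNabla_of_gaugeU h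

/-! ### Spectral consequences -/

lemma intertwines_fourierL2_symm :
    Intertwines fourierL2.symm.toLinearIsometry (mulOp fun ξ => (freq ξ : ℂ)) absNabla where
  map_graph {u g} h := mem_graph_absNabla.2 <| by
    have hu : fourierL2 (fourierL2.symm u) = u := fourierL2.apply_symm_apply u
    have hg : fourierL2 (fourierL2.symm g) = g := fourierL2.apply_symm_apply g
    rw [LinearIsometryEquiv.coe_toLinearIsometry, hu, hg]
    exact mem_graph_mulOp.1 h
  mem_domain {u} h := by
    obtain ⟨g, hg⟩ := absNabla.mem_domain_iff.1 h
    have hu : fourierL2 (fourierL2.symm u) = u := fourierL2.apply_symm_apply u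
    rw [LinearIsometryEquiv.coe_toLinearIsometry, mem_graph_absNabla, hu] at hg
    exact LinearPMap.mem_domain_of_mem_graph (mem_graph_mulOp.2 hg)

lemma eq_zero_of_mem_graph_mulOp_freq (f : L2) (t : ℝ)
    (h : (f, (t : ℂ) • f) ∈ (mulOp fun ξ => (freq ξ : ℂ)).graph) : f = 0 :=
  eq_zero_of_mem_graph_mulOp_smul
    (by simpa [Set.preimage] using volume_preimage_freq (Real.volume_singleton (a := t))) h

/-- The isometry `U 𝓕⁻¹`, which intertwines multiplication by the symbol of `|∇|` with both
`L₊` and `L₋`. -/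
def fourierGauge (m : ℕ) : L2 →ₗᵢ[ℂ] L2 :=
  (gaugeIsometry m).comp fourierL2.symm.toLinearIsometry

lemma rangePerp_fourierGauge (m : ℕ) :
    rangePerp (fourierGauge m) = rangePerp (gaugeIsometry m) := by
  ext f
  rw [mem_rangePerp_iff, mem_rangePerp_iff]
  exact (fourierL2.symm.surjective.forall (p := fun u => ⟪gaugeIsometry m u, f⟫_ℂ = 0)).symm

instance (m : ℕ) : FiniteDimensional ℂ (rangePerp (fourierGauge m)) := by
  rw [rangePerp_fourierGauge]; infer_instance

namespace Intertwines

variable {m : ℕ} {A : L2 →ₗ.[ℂ] L2}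

lemma comp_fourierL2_symm (h : Intertwines (gaugeIsometry m) absNabla A) :
    Intertwines (fourierGauge m) (mulOp fun ξ => (freq ξ : ℂ)) A :=
  h.comp_isometryEquiv intertwines_fourierL2_symm

lemma domain_part_fourierGauge (h : Intertwines (gaugeIsometry m) absNabla A)
    (hA : A.IsFormalAdjoint A) (hdom : A.domain = absNabla.domain) :
    (part A (rangePerp (fourierGauge m))).domain = ⊤ :=
  h.comp_fourierL2_symm.domain_part_rangePerp hA
    (dense_domain_mulOp (Complex.measurable_ofReal.comp continuous_freq.measurable))
    ((rangePerp_fourierGauge m).trans_le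
      ((rangePerp_gaugeIsometry_le_domain_absNabla m).trans hdom.ge))

lemma boundStates_eq_rangePerp (h : Intertwines (gaugeIsometry m) absNabla A)
    (hA : A.IsFormalAdjoint A) (hdom : A.domain = absNabla.domain) :
    boundStates A = rangePerp (gaugeIsometry m) :=
  (h.comp_fourierL2_symm.boundStates_eq hA (h.domain_part_fourierGauge hA hdom)
    eq_zero_of_mem_graph_mulOp_freq).trans (rangePerp_fourierGauge m)

lemma hasPurelyACSpectrumOffBoundStates_Ici (h : Intertwines (gaugeIsometry m) absNabla A)
    (hA : A.IsFormalAdjoint A) (hdom : A.domain = absNabla.domain) :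
    HasPurelyACSpectrumOffBoundStates A (Set.Ici 0) :=
  h.comp_fourierL2_symm.hasPurelyACSpectrumOffBoundStates hA (h.domain_part_fourierGauge hA hdom)
    eq_zero_of_mem_graph_mulOp_freq (mulPVM_represents continuous_freq.measurable)
    (acSubspace_mulPVM _ quasiMeasurePreserving_freq) operatorSpectrum_mulOp_freq

end Intertwines

lemma boundStates_Lplus (m : ℕ) : boundStates (Lplus m) = rangePerp (gaugeIsometry m) :=
  (intertwines_Lplus m).boundStates_eq_rangePerp (isFormalAdjoint_Lplus m) rfl

lemma boundStates_Lminus (m : ℕ) : boundStates (Lminus m) = rangePerp (gaugeIsometry m) :=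
  (intertwines_Lminus m).boundStates_eq_rangePerp (isFormalAdjoint_Lminus m) rfl

lemma orthogonal_boundStates_Lplus (m : ℕ) :
    (boundStates (Lplus m))ᗮ = LinearMap.range (gaugeIsometry m).toLinearMap := by
  rw [boundStates_Lplus, Submodule.orthogonal_orthogonal]

lemma range_Pperp (m : ℕ) : LinearMap.range (Pperp m : L2 →ₗ[ℂ] L2) =
    LinearMap.range (gaugeIsometry m).toLinearMap := by
  have hP : Pperp m = (boundStates (Lplus m))ᗮ.starProjection :=
    (Submodule.starProjection_orthogonal' _).symm
  rw [hP, ← orthogonal_boundStates_Lplus]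
  exact Submodule.range_starProjection _

lemma Pperp_gaugeU (m : ℕ) (f : L2) : Pperp m (gaugeU m f) = gaugeU m f := by
  have hU : gaugeU m f ∈ (boundStates (Lplus m))ᗮ :=
    (orthogonal_boundStates_Lplus m).ge ⟨f, rfl⟩
  rw [Pperp, boundProj, sub_apply, one_def, id_apply,
    (Submodule.starProjection_apply_eq_zero_iff _).2 hU, sub_zero]

lemma sandwich_eq_absNabla {m : ℕ} {A : L2 →ₗ.[ℂ] L2}
    (h : Intertwines (gaugeIsometry m) absNabla A) :
    sandwich (adjoint (gaugeU m) ∘L Pperp m) A (Pperp m ∘L gaugeU m) = absNabla := by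
  refine LinearPMap.eq_of_eq_graph (Submodule.ext fun ⟨f, g⟩ => ?_)
  rw [mem_graph_sandwich_iff, comp_apply, Pperp_gaugeU, ← gaugeIsometry_apply]
  constructor
  · rintro ⟨v, hv, rfl⟩
    obtain ⟨g, hg, rfl⟩ := h.mem_graph_iff.1 hv
    rwa [comp_apply, gaugeIsometry_apply, Pperp_gaugeU, adjoint_gaugeU_gaugeU]
  · intro hg
    refine ⟨_, h.map_graph hg, ?_⟩
    rw [comp_apply, gaugeIsometry_apply, Pperp_gaugeU, adjoint_gaugeU_gaugeU]

end HalfHarmonic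

end

theorem theorem5 (m : ℕ) (hm : 1 ≤ m) :
    -- `U` is a unitary map from `L²(ℝ)` onto `P^⊥ L²(ℝ)`, with its explicit adjoint
    (∃ V : L2 ≃ₗᵢ[ℂ] LinearMap.range (Pperp m : L2 →ₗ[ℂ] L2), ∀ f, (V f : L2) = gaugeU m f) ∧
    (∀ g ∈ LinearMap.range (Pperp m : L2 →ₗ[ℂ] L2),
      adjoint (gaugeU m) g = mulQConj m (projPos g) + mulQ m (projNeg g)) ∧
    -- `U* P^⊥ L₊ P^⊥ U = |∇|` and `U* P^⊥ L₋ P^⊥ U = |∇|`, including equality of domains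
    sandwich (adjoint (gaugeU m) ∘L Pperp m) (Lplus m) (Pperp m ∘L gaugeU m) = absNabla ∧
    sandwich (adjoint (gaugeU m) ∘L Pperp m) (Lminus m) (Pperp m ∘L gaugeU m) = absNabla ∧
    -- both operators have the same bound states, and purely absolutely continuous spectrum
    -- `[0, ∞)` on the complement
    boundStates (Lminus m) = boundStates (Lplus m) ∧
    HasPurelyACSpectrumOffBoundStates (Lplus m) (Set.Ici 0) ∧
    HasPurelyACSpectrumOffBoundStates (Lminus m) (Set.Ici 0) := by
  refine ⟨⟨(gaugeIsometry m).equivRange.trans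
      (LinearIsometryEquiv.ofEq _ _ (range_Pperp m).symm), fun _ => rfl⟩, fun g hg => ?_,
    sandwich_eq_absNabla (intertwines_Lplus m), sandwich_eq_absNabla (intertwines_Lminus m),
    (boundStates_Lminus m).trans (boundStates_Lplus m).symm,
    (intertwines_Lplus m).hasPurelyACSpectrumOffBoundStates_Ici (isFormalAdjoint_Lplus m) rfl,
    (intertwines_Lminus m).hasPurelyACSpectrumOffBoundStates_Ici (isFormalAdjoint_Lminus m) rfl⟩
  obtain ⟨f, rfl⟩ := (range_Pperp m).le hg
  exact (adjoint_gaugeU_gaugeU m f).trans (mulQConj_projPos_add_mulQ_projNeg_gaugeU m f).symm
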